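/- Let $\mathbb{A}$ be a commutative associative unital algebra of finite dimension $n\ge 1$ over $\mathbb{C}$, with basis $I_1,\dots,I_n$ and with its topology of a finite-dimensional complex vector space. Let $2\le k\le 2n$, let $e_1=1,e_2,\dots,e_k\in\mathbb{A}$ be linearly independent over $\mathbb{R}$, let $E_k=\{\sum_{j=1}^k x_je_j : x_j\in\mathbb{R}\}$, with the topology carried over from $\mathbb{R}^k$ by the coordinates $(x_1,\dots,x_k)$, and assume that $f(E_k)=\mathbb{C}$ for every unital algebra homomorphism $f:\mathbb{A}\to\mathbb{C}$. Let $\Omega\subset E_k$ be a domain (a nonempty connected open subset of $E_k$), and let $\Phi:\Omega\to\mathbb{A}$ be monogenic, that is, $\Phi$ is continuous and for every $\zeta\in\Omega$ there is $\Phi'(\zeta)\in\mathbb{A}$ such that $$\lim_{\varepsilon\to 0+}\frac{\Phi(\zeta+\varepsilon h)-\Phi(\zeta)}{\varepsilon}=h\,\Phi'(\zeta)\qquad\text{for all } h\in E_k .$$ Then for every closed rectifiable Jordan curve $\gamma$ in $\Omega$ that is homotopic to a point in $\Omega$, $$\int_\gamma \Phi(\zeta)\,d\zeta=0 .$$ Here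 $d\zeta=e_1dx_1+\dots+e_kdx_k$, and if $\Phi=\sum_{r=1}^n (U_r+iV_r)I_r$ with $U_r,V_r$ real-valued, the integral is defined through Riemann–Stieltjes integrals by $$\int_\gamma\Phi(\zeta)\,d\zeta=\sum_{j=1}^k e_j\sum_{r=1}^n I_r\int_{\gamma}U_r\,dx_j+i\sum_{j=1}^k e_j\sum_{r=1}^n I_r\int_{\gamma}V_r\,dx_j .$$ -/

import Mathlib

open Filter Topology Set

noncomputable section

namespace Monogenic

/-- The point `∑ⱼ xⱼ eⱼ` with real coordinates `x` in the system `e`. -/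
def point {A : Type*} [CommRing A] [Algebra ℂ A] {k : ℕ} (e : Fin k → A)
    (x : EuclideanSpace ℝ (Fin k)) : A :=
  ∑ j, x j • e j

/-- The space `E_k`, the real linear span of `e₁, …, e_k`. -/
def realSpan {A : Type*} [CommRing A] [Algebra ℂ A] {k : ℕ} (e : Fin k → A) : Submodule ℝ A :=
  Submodule.span ℝ (range e)

/-- The subset `Q_ℝ` of `ℝ^k` that corresponds to a subset `Q` of `E_k`. -/
def realSet {A : Type*} [CommRing A] [Algebra ℂ A] {k : ℕ} (e : Fin k → A) (Q : Set A) :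
    Set (EuclideanSpace ℝ (Fin k)) :=
  {x | point e x ∈ Q}

/-- `Ω` is a domain in `E_k`: a subset of `E_k` which is open and connected (and nonempty) in the
coordinates `x ∈ ℝ^k`. -/
structure IsDomainIn {A : Type*} [CommRing A] [Algebra ℂ A] {k : ℕ} (e : Fin k → A)
    (Ω : Set A) : Prop where
  subset : Ω ⊆ realSpan e
  isOpen : IsOpen (realSet e Ω)
  isConnected : IsConnected (realSet e Ω)

/-- `Φ` is monogenic in `Ω ⊆ E_k`: it is continuous in `Ω` and at every `ζ ∈ Ω` it has a Gateaux
derivative, an element `d` of the algebra such that the one-sided directional derivative of `Φ`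
at `ζ` along every `h ∈ E_k` equals `h * d`. Only the values of `Φ` in `Ω` matter, as `Ω` is open
in `E_k`. -/
structure IsMonogenicOn {A : Type*} [CommRing A] [Algebra ℂ A] [TopologicalSpace A] {k : ℕ}
    (e : Fin k → A) (Φ : A → A) (Ω : Set A) : Prop where
  continuousOn : ContinuousOn (fun x => Φ (point e x)) (realSet e Ω)
  gateaux : ∀ ζ ∈ Ω, ∃ d : A, ∀ h ∈ realSpan e,
    Tendsto (fun ε : ℝ => ε⁻¹ • (Φ (ζ + ε • h) - Φ ζ)) (𝓝[>] 0) (𝓝 (h * d))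

/-- The Riemann-Stieltjes integral `∫₀¹ f dg` exists and equals `J`: the Riemann-Stieltjes sums
over the tagged partitions `0 = t₀ ≤ t₁ ≤ ⋯ ≤ t_N = 1` of the unit interval, with tags
`ξᵢ ∈ [tᵢ, tᵢ₊₁]`, tend to `J` as the mesh tends to zero. -/
def HasStieltjesIntegral (f g : ℝ → ℝ) (J : ℝ) : Prop :=
  ∀ ε : ℝ, 0 < ε → ∃ δ : ℝ, 0 < δ ∧ ∀ (N : ℕ) (t ξ : ℕ → ℝ), t 0 = 0 → t N = 1 →
    (∀ i < N, ξ i ∈ Icc (t i) (t (i + 1)) ∧ t (i + 1) - t i < δ) →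
    |∑ i ∈ Finset.range N, f (ξ i) * (g (t (i + 1)) - g (t i)) - J| < ε

/-- The curvilinear integral `∫_γ Ψ(ζ) dζ`, `dζ = e₁ dx₁ + ⋯ + e_k dx_k`, along the curve
`γ = {∑ⱼ xⱼ(t) eⱼ : 0 ≤ t ≤ 1}` exists and equals `z`. With `Ψ = ∑ᵣ Uᵣ Iᵣ + i ∑ᵣ Vᵣ Iᵣ`,
`Uᵣ` and `Vᵣ` real, the integral is
`∑ⱼ eⱼ ∑ᵣ Iᵣ ∫ Uᵣ dxⱼ + i ∑ⱼ eⱼ ∑ᵣ Iᵣ ∫ Vᵣ dxⱼ`. -/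
def HasCurveIntegral {A : Type*} [CommRing A] [Algebra ℂ A] {n k : ℕ}
    (I : Module.Basis (Fin n) ℂ A) (e : Fin k → A) (Ψ : A → A)
    (x : ℝ → EuclideanSpace ℝ (Fin k)) (z : A) : Prop :=
  ∃ P Q : Fin k → Fin n → ℝ,
    (∀ j r, HasStieltjesIntegral (fun t => (I.repr (Ψ (point e (x t))) r).re)
      (fun t => x t j) (P j r)) ∧
    (∀ j r, HasStieltjesIntegral (fun t => (I.repr (Ψ (point e (x t))) r).im)
      (fun t => x t j) (Q j r)) ∧
    z = (∑ j, e j * ∑ r, P j r • I r) + Complex.I • (∑ j, e j * ∑ r, Q j r • I r)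

end Monogenic

end

noncomputable section

open MeasureTheory NNReal

namespace Monogenic

/-! For a real functional `ℓ` of the algebra, `ℓ (Φ dζ)` is a real 1-form on an open subset of
`ℝ^k`. Its coefficient at `h'` has derivative `ℓ (h' h Φ')` along `h`, which is symmetric in `h, h'`
because the algebra is commutative. The form is thus continuous and closed, but only in the Gateaux
sense: neither total differentiability nor continuity of the derivatives is available, so the
classical Green theorem does not apply.

The substitute is an argument of Looman–Menchoff type (`subset_conservativeSet`). Let `G` be the
open set of points near which integrals of `u ds + v dt` along boundaries of rectangles vanish. If
`G` misses a point of the domain, Baire's theorem gives a relatively open piece of the complement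
from whose points `u` and `v` are uniformly Lipschitz along the axes. For a small rectangle `Q` put
`E = Q \ G`. The boundary integral differs from the integral over `E` of the curl, which is zero, by
at most a constant times the area of `Q ∩ G` (`abs_rectIntegral_le`). After fine subdivision only
cells that meet `E` contribute, so `Q ∩ G` may be replaced by its part close to `E`, whose area
tends to zero. Hence the piece lies in `G`, a contradiction.

Pulling the form back along a cone over a segment gives zero integrals over small triangles
(`IsGateauxClosedOn.segmentIntegral_add`). A grid on the homotopy then kills the integrals over fine
inscribed polygons, and rectifiability identifies their limit with the Stieltjes integral. Since `ℓ`
is arbitrary, the integral of `Φ` vanishes. -/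

/-! ### Increments of Lipschitz functions and integrals of derivatives over closed sets. -/

theorem ae_uniqueDiffWithinAt_of_mem (E : Set ℝ) :
    ∀ᵐ x : ℝ, x ∈ E → UniqueDiffWithinAt ℝ E x := by
  -- Only countably many points of a set are isolated in it from the right.
  have h : {x ∈ E | 𝓝[E ∩ Ioi x] x = ⊥}.Countable := countable_setOfPred_isolated_right_within
  filter_upwards [h.ae_notMem volume] with x hx hxE
  rw [uniqueDiffWithinAt_iff_accPt, accPt_principal_iff_nhdsWithin]
  have : (𝓝[E ∩ Ioi x] x).NeBot := ⟨fun h0 => hx ⟨hxE, h0⟩⟩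
  refine this.mono (nhdsWithin_mono x ?_)
  rintro y ⟨hy, hxy⟩
  exact ⟨hy, ne_of_gt hxy⟩

/-- The increment of a function which is Lipschitz as seen from the points of a closed set `E`,
compared with the integral of its derivative over `E`. -/
theorem abs_sub_sub_setIntegral_deriv_le {g g' : ℝ → ℝ} {a b : ℝ} {E : Set ℝ} {N : ℝ≥0}
    (hE : IsClosed E) (hEab : E ⊆ Icc a b) (hne : E.Nonempty)
    (hN : ∀ x ∈ E, ∀ y ∈ Icc a b, |g y - g x| ≤ N * |y - x|)
    (hg : ∀ x ∈ E, HasDerivAt g (g' x) x) :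
    |g b - g a - ∫ x in E, g' x| ≤ N * volume.real (Icc a b \ E) := by
  obtain ⟨p, hp⟩ := hne
  have hpab := hEab hp
  have hab : a ≤ b := hpab.1.trans hpab.2
  -- The endpoints need not lie in `E`. Passing through `p ∈ E` between them loses nothing, since
  -- the two steps add up to `b - a`.
  have hend : |g b - g a| ≤ N * |b - a| := by
    have h1 := hN p hp b ⟨hab, le_rfl⟩
    have h2 := hN p hp a ⟨le_rfl, hab⟩
    rw [abs_of_nonneg (by linarith [hpab.2] : 0 ≤ b - p)] at h1
    rw [abs_of_nonpos (by linarith [hpab.1] : a - p ≤ 0)] at h2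
    rw [abs_of_nonneg (by linarith : 0 ≤ b - a)]
    rw [abs_le] at *
    constructor <;> linarith [h1.1, h1.2, h2.1, h2.2]
  have hlip : LipschitzOnWith N g (insert a (insert b E)) := by
    refine LipschitzOnWith.of_dist_le_mul ?_
    have hm : ∀ x ∈ insert a (insert b E), x ∈ Icc a b := by
      rintro x (rfl | rfl | hx)
      exacts [⟨le_rfl, hab⟩, ⟨hab, le_rfl⟩, hEab hx]
    have hs : ∀ x ∈ E, ∀ y ∈ Icc a b, |g x - g y| ≤ N * |x - y| := fun x hx y hy => by
      rw [abs_sub_comm, abs_sub_comm x]; exact hN x hx y hy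
    intro x hx y hy
    rw [Real.dist_eq, Real.dist_eq]
    by_cases hxE : x ∈ E
    · exact hs x hxE y (hm y hy)
    by_cases hyE : y ∈ E
    · exact hN y hyE x (hm x hx)
    rcases hx with rfl | rfl | hx
    · rcases hy with rfl | rfl | hy
      · simp
      · rw [abs_sub_comm, abs_sub_comm x]; exact hend
      · exact absurd hy hyE
    · rcases hy with rfl | rfl | hy
      · exact hend
      · simp
      · exact absurd hy hyE
    · exact absurd hx hxE
  -- The extension `f` obeys the fundamental theorem of calculus. Its derivative agrees with `g'`
  -- almost everywhere on `E` and is at most `N` elsewhere, which gives the error term.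
  obtain ⟨f, hf, hfg⟩ := hlip.extend_real
  have hfa : g a = f a := hfg (by simp)
  have hfb : g b = f b := hfg (by simp)
  have hfE : EqOn g f E := fun x hx => hfg (by simp [hx])
  have hftc : ∫ x in Icc a b, deriv f x = f b - f a := by
    rw [integral_Icc_eq_integral_Ioc, ← intervalIntegral.integral_of_le hab]
    exact (hf.lipschitzOnWith (s := uIcc a b)).absolutelyContinuousOnInterval.integral_deriv_eq_sub
  have hint : IntegrableOn (deriv f) (Icc a b) := by
    refine Measure.integrableOn_of_bounded (M := N) (by simp)
      (measurable_deriv f).aestronglyMeasurable ?_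
    exact Eventually.of_forall fun x => norm_deriv_le_of_lipschitz hf
  have hEm := hE.measurableSet
  have hder : ∫ x in E, g' x = ∫ x in E, deriv f x := by
    refine setIntegral_congr_ae hEm ?_
    filter_upwards [hf.ae_differentiableAt_real, ae_uniqueDiffWithinAt_of_mem E] with x h1 h2 hx
    exact (h2 hx).eq_deriv E (hg x hx).hasDerivWithinAt
      (h1.hasDerivAt.hasDerivWithinAt.congr hfE (hfE hx))
  have hdiff := setIntegral_sdiff hEm hint hEab
  rw [hder, hfa, hfb, ← hftc, ← hdiff, ← Real.norm_eq_abs]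
  refine norm_setIntegral_le_of_norm_le_const ?_ fun x _ => norm_deriv_le_of_lipschitz hf
  exact (measure_mono sdiff_subset).trans_lt measure_Icc_lt_top

/-- The increments over `[a, b]` along the rows `t ∈ [c, d]` of a function of two variables which
is Lipschitz along the axes as seen from the points of a closed set `E ⊆ [a, b] × [c, d]` that
meets both vertical edges, compared with the integral over `E` of the derivative. -/
theorem abs_integral_sub_sub_setIntegral_deriv_le {w w' : ℝ × ℝ → ℝ} {a b c d x₀ x₁ κ : ℝ}
    {E : Set (ℝ × ℝ)} {N : ℝ≥0} (hw : Continuous w) (hw' : Measurable w')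
    (hE : IsClosed E) (hER : E ⊆ Icc a b ×ˢ Icc c d)
    (hl : ∃ t, (a, t) ∈ E) (hr : ∃ t, (b, t) ∈ E)
    (hNx : ∀ z ∈ E, ∀ x ∈ Icc a b, |w (x, z.2) - w z| ≤ N * |x - z.1|)
    (hNy : ∀ z ∈ E, ∀ y ∈ Icc c d, |w (z.1, y) - w z| ≤ N * |y - z.2|)
    (hd : ∀ z ∈ E, HasDerivAt (fun s => w (s, z.2)) (w' z) z.1)
    (hw'N : ∀ z ∈ E, ‖w' z‖ ≤ N)
    (hx₀ : x₀ ≤ a) (hx₁ : b ≤ x₁) (hκ : 1 ≤ κ)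
    (hκ' : (b - a) + 3 * (d - c) ≤ κ * (x₁ - x₀)) :
    |(∫ t in c..d, (w (b, t) - w (a, t))) - ∫ z in E, w' z| ≤
      N * κ * volume.real ((Icc x₀ x₁ ×ˢ Icc c d) \ E) := by
  obtain ⟨tl, htl⟩ := hl
  obtain ⟨tr, htr⟩ := hr
  have hab : a ≤ b := (hER htl).1.2
  have hcd : c ≤ d := (hER htl).2.1.trans (hER htl).2.2
  have hEm := hE.measurableSet
  set Q := Icc x₀ x₁ ×ˢ Icc c d with hQ
  have hQm : MeasurableSet Q := measurableSet_Icc.prod measurableSet_Icc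
  have hDm : MeasurableSet (Q \ E) := hQm.diff hEm
  have hrow : ∀ t ∈ Icc c d, |w (b, t) - w (a, t) - ∫ s in {s | (s, t) ∈ E}, w' (s, t)| ≤
      N * κ * volume.real {s | (s, t) ∈ Q \ E} := by
    intro t ht
    have hcl : IsClosed {s | (s, t) ∈ E} := hE.preimage (by fun_prop)
    have hfin : volume {s | (s, t) ∈ Q \ E} ≠ ⊤ := by
      refine ne_top_of_le_ne_top (measure_Icc_lt_top (a := x₀) (b := x₁)).ne
        (measure_mono fun s hs => hs.1.1)
    rcases Set.eq_empty_or_nonempty {s | (s, t) ∈ E} with he | hne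
    · have hset : {s | (s, t) ∈ Q \ E} = Icc x₀ x₁ := by
        ext s
        have : (s, t) ∉ E := fun h => by
          have : s ∈ {s | (s, t) ∈ E} := h
          rw [he] at this; exact this
        simp [hQ, this, ht.1, ht.2]
      rw [he, hset, setIntegral_empty, sub_zero, Real.volume_real_Icc_of_le (by linarith)]
      -- The row misses `E`, so the increment is estimated along the detour `(b, t)`, `(b, tr)`,
      -- `(b, tl)`, `(a, tl)`, `(a, t)`, of length at most `(b - a) + 3 * (d - c)`. The whole width
      -- `x₁ - x₀` of the row counts in `Q \ E`, so `κ` absorbs this cost.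
      have h1 := hNy _ htr t ht
      have h2 := hNy _ htl t ht
      have h3 := hNx _ htl b ⟨hab, le_rfl⟩
      have h4 := hNy _ htr tl (hER htl).2
      simp only at h1 h2 h3 h4
      have hsp : ∀ p ∈ Icc c d, ∀ q ∈ Icc c d, |p - q| ≤ d - c := fun p hp q hq => by
        rw [abs_le]; constructor <;> linarith [hp.1, hp.2, hq.1, hq.2]
      have e1 : |w (b, t) - w (b, tr)| ≤ N * (d - c) :=
        h1.trans (by gcongr; exact hsp _ ht _ (hER htr).2)
      have e2 : |w (a, t) - w (a, tl)| ≤ N * (d - c) :=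
        h2.trans (by gcongr; exact hsp _ ht _ (hER htl).2)
      have e4 : |w (b, tl) - w (b, tr)| ≤ N * (d - c) :=
        h4.trans (by gcongr; exact hsp _ (hER htl).2 _ (hER htr).2)
      rw [abs_of_nonneg (by linarith : 0 ≤ b - a)] at h3
      have hm : (N : ℝ) * ((b - a) + 3 * (d - c)) ≤ N * (κ * (x₁ - x₀)) := by gcongr
      rw [abs_le] at *
      constructor <;> linarith [e1.1, e1.2, e2.1, e2.2, h3.1, h3.2, e4.1, e4.2]
    · have h := abs_sub_sub_setIntegral_deriv_le (g := fun s => w (s, t))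
        (g' := fun s => w' (s, t)) (a := a) (b := b) (N := N) hcl (fun s hs => (hER hs).1) hne
        (fun x hx y hy => hNx _ hx y hy) (fun x hx => hd _ hx)
      refine h.trans ?_
      have hsub : volume.real (Icc a b \ {s | (s, t) ∈ E}) ≤ volume.real {s | (s, t) ∈ Q \ E} := by
        refine measureReal_mono ?_ hfin
        rintro s ⟨hs, hsE⟩
        exact ⟨⟨⟨hx₀.trans hs.1, hs.2.trans hx₁⟩, ht⟩, hsE⟩
      calc (N : ℝ) * volume.real (Icc a b \ {s | (s, t) ∈ E})
          ≤ N * 1 * volume.real {s | (s, t) ∈ Q \ E} := by rw [mul_one]; gcongr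
        _ ≤ N * κ * volume.real {s | (s, t) ∈ Q \ E} := by gcongr
  have hEfin : volume E ≠ ⊤ :=
    ne_top_of_le_ne_top (isCompact_Icc.prod isCompact_Icc).measure_lt_top.ne (measure_mono hER)
  have hw'int : Integrable (E.indicator w') := by
    rw [integrable_indicator_iff hEm]
    refine Measure.integrableOn_of_bounded (M := N) hEfin hw'.aestronglyMeasurable ?_
    exact (ae_restrict_iff' hEm).2 (Eventually.of_forall hw'N)
  have hDfin : volume (Q \ E) ≠ ⊤ :=
    ne_top_of_le_ne_top (isCompact_Icc.prod isCompact_Icc).measure_lt_top.ne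
      (measure_mono sdiff_subset)
  have hDint : Integrable ((Q \ E).indicator (fun _ => (1 : ℝ))) := by
    rw [integrable_indicator_iff hDm]
    exact integrableOn_const hDfin
  have hfub : ∀ (S : Set (ℝ × ℝ)) (f : ℝ × ℝ → ℝ), MeasurableSet S → S ⊆ univ ×ˢ Icc c d →
      Integrable (S.indicator f) →
      ∫ z in S, f z = ∫ t in c..d, ∫ s in {s | (s, t) ∈ S}, f (s, t) := by
    intro S f hS hSsub hf
    rw [← integral_indicator hS, Measure.volume_eq_prod, integral_prod_symm _ hf,
      intervalIntegral.integral_of_le hcd, ← integral_Icc_eq_integral_Ioc,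
      ← integral_indicator measurableSet_Icc]
    refine integral_congr_ae (Eventually.of_forall fun t => ?_)
    by_cases ht : t ∈ Icc c d
    · have hSt : MeasurableSet {s | (s, t) ∈ S} := hS.preimage (by fun_prop)
      rw [indicator_of_mem ht, ← integral_indicator hSt]
      rfl
    · rw [indicator_of_notMem ht]
      have : ∀ s, S.indicator f (s, t) = 0 := fun s =>
        indicator_of_notMem (fun h => ht (hSsub h).2) _
      simp [this]
  have hint : ∀ (S : Set (ℝ × ℝ)) (f : ℝ × ℝ → ℝ), MeasurableSet S →
      Integrable (S.indicator f) →
      IntervalIntegrable (fun t => ∫ s in {s | (s, t) ∈ S}, f (s, t)) volume c d := by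
    intro S f hS hf
    have := (Integrable.integral_prod_right hf).intervalIntegrable (a := c) (b := d)
    refine this.congr fun t _ => ?_
    have hSt : MeasurableSet {s | (s, t) ∈ S} := hS.preimage (by fun_prop)
    rw [← integral_indicator hSt]
    rfl
  have hvol : volume.real (Q \ E) = ∫ t in c..d, volume.real {s | (s, t) ∈ Q \ E} := by
    have := hfub (Q \ E) (fun _ => 1) hDm (fun z hz => ⟨trivial, hz.1.2⟩) hDint
    simpa using this
  have hvint : IntervalIntegrable (fun t => volume.real {s | (s, t) ∈ Q \ E}) volume c d := by
    have := hint (Q \ E) (fun _ => 1) hDm hDint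
    simpa using this
  have hwint : IntervalIntegrable (fun t => w (b, t) - w (a, t)) volume c d :=
    Continuous.intervalIntegrable (by fun_prop) _ _
  rw [hfub E w' hEm (fun z hz => ⟨trivial, (hER hz).2⟩) hw'int,
    ← intervalIntegral.integral_sub hwint (hint E w' hEm hw'int), hvol,
    ← intervalIntegral.integral_const_mul]
  refine (intervalIntegral.abs_integral_le_integral_abs hcd).trans ?_
  refine intervalIntegral.integral_mono_on hcd ?_ (hvint.const_mul _) hrow
  exact (hwint.sub (hint E w' hEm hw'int)).abs

/-! ### Boundary integrals of rectangles and subdivision. -/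

/-- The integral of `u ds + v dt` along the boundary of `[a, b] × [c, d]`. -/
def rectIntegral (u v : ℝ × ℝ → ℝ) (a b c d : ℝ) : ℝ :=
  (∫ t in c..d, (v (b, t) - v (a, t))) - ∫ s in a..b, (u (s, d) - u (s, c))

section rectIntegral

variable {u v : ℝ × ℝ → ℝ}

theorem rectIntegral_add_horizontal (hu : Continuous u) (hv : Continuous v) (a m b c d : ℝ) :
    rectIntegral u v a m c d + rectIntegral u v m b c d = rectIntegral u v a b c d := by
  unfold rectIntegral
  have hi : ∀ x y, IntervalIntegrable (fun s => u (s, d) - u (s, c)) volume x y := fun x y =>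
    Continuous.intervalIntegrable (by fun_prop) _ _
  have hj : ∀ x y, IntervalIntegrable (fun t => v (x, t) - v (y, t)) volume c d := fun x y =>
    Continuous.intervalIntegrable (by fun_prop) _ _
  rw [← intervalIntegral.integral_add_adjacent_intervals (hi a m) (hi m b)]
  have : ∫ t in c..d, (v (b, t) - v (a, t)) =
      (∫ t in c..d, (v (m, t) - v (a, t))) + ∫ t in c..d, (v (b, t) - v (m, t)) := by
    rw [← intervalIntegral.integral_add (hj _ _) (hj _ _)]
    congr 1; ext t; ring
  rw [this]; ring

theorem rectIntegral_swap (a b c d : ℝ) :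
    rectIntegral (v ∘ Prod.swap) (u ∘ Prod.swap) c d a b = -rectIntegral u v a b c d := by
  simp [rectIntegral]

theorem rectIntegral_add_vertical (hu : Continuous u) (hv : Continuous v) (a b c m d : ℝ) :
    rectIntegral u v a b c m + rectIntegral u v a b m d = rectIntegral u v a b c d := by
  have := rectIntegral_add_horizontal (hv.comp continuous_swap) (hu.comp continuous_swap) c m d a b
  simp only [rectIntegral_swap] at this
  linarith

theorem continuous_rectIntegral_horizontal (hu : Continuous u) (hv : Continuous v) (c d : ℝ) :
    Continuous fun p : ℝ × ℝ => rectIntegral u v p.1 p.2 c d := by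
  unfold rectIntegral
  refine Continuous.sub ?_ ?_
  · exact intervalIntegral.continuous_parametric_intervalIntegral_of_continuous
      (f := fun (p : ℝ × ℝ) t => v (p.2, t) - v (p.1, t)) (by fun_prop) continuous_const
  · have hi : ∀ x y, IntervalIntegrable (fun s => u (s, d) - u (s, c)) volume x y := fun x y =>
      Continuous.intervalIntegrable (by fun_prop) _ _
    have : (fun p : ℝ × ℝ => ∫ s in p.1..p.2, (u (s, d) - u (s, c))) = fun p : ℝ × ℝ =>
        (∫ s in (0 : ℝ)..p.2, (u (s, d) - u (s, c))) -
          ∫ s in (0 : ℝ)..p.1, (u (s, d) - u (s, c)) := by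
      ext p; rw [intervalIntegral.integral_interval_sub_left (hi _ _) (hi _ _)]
    rw [this]
    have hp := intervalIntegral.continuous_primitive (μ := volume) hi 0
    exact (hp.comp continuous_snd).sub (hp.comp continuous_fst)

/-- The integral depends continuously on the vertical edges. This serves strips with an edge that
may leave the conservative set. -/
theorem rectIntegral_eq_zero_of_interior (hu : Continuous u) (hv : Continuous v) {a b c d : ℝ}
    (hab : a ≤ b) (h : ∀ a' b', a < a' → a' ≤ b' → b' < b → rectIntegral u v a' b' c d = 0) :
    rectIntegral u v a b c d = 0 := by
  rcases hab.eq_or_lt with rfl | hab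
  · simp [rectIntegral]
  have hcont : Continuous fun τ : ℝ => rectIntegral u v (a + τ) (b - τ) c d :=
    (continuous_rectIntegral_horizontal hu hv c d).comp (by fun_prop : Continuous fun τ : ℝ =>
      (a + τ, b - τ))
  have h1 : Tendsto (fun τ : ℝ => rectIntegral u v (a + τ) (b - τ) c d) (𝓝[>] 0)
      (𝓝 (rectIntegral u v a b c d)) := by
    have := hcont.tendsto 0
    simp only [add_zero, sub_zero] at this
    exact this.mono_left nhdsWithin_le_nhds
  refine tendsto_nhds_unique h1 (tendsto_const_nhds.congr' ?_)
  have : Ioo (0 : ℝ) ((b - a) / 2) ∈ 𝓝[>] (0 : ℝ) := Ioo_mem_nhdsGT (by linarith)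
  filter_upwards [this] with τ hτ
  exact (h _ _ (by linarith [hτ.1]) (by linarith [hτ.2]) (by linarith [hτ.1])).symm

end rectIntegral

/-- A property of rectangles that is inherited from halves holds for a rectangle if it holds for
the small rectangles of the same shape in it. -/
theorem rect_induction {F : ℝ → ℝ → ℝ → ℝ → Prop}
    (hx : ∀ a m b c d, a ≤ m → m ≤ b → c ≤ d → F a m c d → F m b c d → F a b c d)
    (hy : ∀ a b c m d, a ≤ b → c ≤ m → m ≤ d → F a b c m → F a b m d → F a b c d)
    {A B C D : ℝ} (hAB : A ≤ B) (hCD : C ≤ D) (n : ℕ)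
    (h : ∀ a c, A ≤ a → a + (B - A) / 2 ^ n ≤ B → C ≤ c → c + (D - C) / 2 ^ n ≤ D →
      F a (a + (B - A) / 2 ^ n) c (c + (D - C) / 2 ^ n)) : F A B C D := by
  induction n with
  | zero => simpa using h A C le_rfl (by simp) le_rfl (by simp)
  | succ n ih =>
    apply ih
    intro a c ha ha' hc hc'
    have e1 : (B - A) / 2 ^ n = (B - A) / 2 ^ (n + 1) + (B - A) / 2 ^ (n + 1) := by
      rw [pow_succ]; ring
    have e2 : (D - C) / 2 ^ n = (D - C) / 2 ^ (n + 1) + (D - C) / 2 ^ (n + 1) := by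
      rw [pow_succ]; ring
    have p1 : 0 ≤ (B - A) / 2 ^ (n + 1) := div_nonneg (by linarith) (by positivity)
    have p2 : 0 ≤ (D - C) / 2 ^ (n + 1) := div_nonneg (by linarith) (by positivity)
    rw [e1] at ha' ⊢
    rw [e2] at hc' ⊢
    set p := (B - A) / 2 ^ (n + 1)
    set q := (D - C) / 2 ^ (n + 1)
    rw [← add_assoc, ← add_assoc]
    refine hx a (a + p) _ _ _ (by linarith) (by linarith) (by linarith) ?_ ?_
    · refine hy _ _ c (c + q) _ (by linarith) (by linarith) (by linarith) ?_ ?_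
      · exact h a c ha (by linarith) hc (by linarith)
      · exact h a (c + q) ha (by linarith) (by linarith) (by linarith)
    · refine hy _ _ c (c + q) _ (by linarith) (by linarith) (by linarith) ?_ ?_
      · exact h (a + p) c (by linarith) (by linarith) hc (by linarith)
      · exact h (a + p) (c + q) (by linarith) (by linarith) (by linarith) (by linarith)

theorem exists_div_two_pow_lt (x y : ℝ) {δ : ℝ} (hδ : 0 < δ) :
    ∃ n : ℕ, x / 2 ^ n < δ ∧ y / 2 ^ n < δ := by
  have h : ∀ x : ℝ, Tendsto (fun n : ℕ => x / 2 ^ n) atTop (𝓝 0) := fun x =>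
    tendsto_const_nhds.div_atTop (tendsto_pow_atTop_atTop_of_one_lt one_lt_two)
  exact (((h x).eventually_lt_const hδ).and ((h y).eventually_lt_const hδ)).exists

/-! ### The conservative set. -/

/-- The points near which all the integrals along boundaries of rectangles vanish. -/
def conservativeSet (u v : ℝ × ℝ → ℝ) : Set (ℝ × ℝ) :=
  {z | ∃ r > 0, ∀ a b c d, a ≤ b → c ≤ d → Icc a b ×ˢ Icc c d ⊆ Metric.ball z r →
    rectIntegral u v a b c d = 0}

section conservativeSet

variable {u v : ℝ × ℝ → ℝ}

theorem isOpen_conservativeSet : IsOpen (conservativeSet u v) := by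
  rw [Metric.isOpen_iff]
  rintro z ⟨r, hr, h⟩
  refine ⟨r / 2, by positivity, fun y hy => ⟨r / 2, by positivity, ?_⟩⟩
  intro a b c d hab hcd hsub
  refine h a b c d hab hcd (hsub.trans (Metric.ball_subset_ball' ?_))
  have := Metric.mem_ball.1 hy
  linarith

/-- A Lebesgue number of the cover by the defining balls makes all sufficiently fine dyadic cells
harmless; additivity does the rest. -/
theorem rectIntegral_eq_zero_of_subset_conservativeSet (hu : Continuous u) (hv : Continuous v)
    {a b c d : ℝ} (hab : a ≤ b) (hcd : c ≤ d)
    (h : Icc a b ×ˢ Icc c d ⊆ conservativeSet u v) : rectIntegral u v a b c d = 0 := by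
  choose! r hr hz using fun (z : ℝ × ℝ) (hz : z ∈ conservativeSet u v) => hz
  obtain ⟨δ, hδ, hL⟩ := lebesgue_number_lemma_of_metric (ι := conservativeSet u v)
    (c := fun z => Metric.ball (z : ℝ × ℝ) (r z))
    (isCompact_Icc.prod isCompact_Icc : IsCompact (Icc a b ×ˢ Icc c d))
    (fun _ => Metric.isOpen_ball)
    (fun z hzm => mem_iUnion.2 ⟨⟨z, h hzm⟩, Metric.mem_ball_self (hr z (h hzm))⟩)
  obtain ⟨n, hn1, hn2⟩ := exists_div_two_pow_lt (b - a) (d - c) hδ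
  refine rect_induction (F := fun a b c d => rectIntegral u v a b c d = 0) ?_ ?_ hab hcd n ?_
  · intro a m b c d _ _ _ h1 h2
    rw [← rectIntegral_add_horizontal hu hv a m b, h1, h2, add_zero]
  · intro a b c m d _ _ _ h1 h2
    rw [← rectIntegral_add_vertical hu hv a b c m, h1, h2, add_zero]
  · intro a' c' h1 h2 h3 h4
    have p1 : 0 ≤ (b - a) / 2 ^ n := div_nonneg (by linarith) (by positivity)
    have p2 : 0 ≤ (d - c) / 2 ^ n := div_nonneg (by linarith) (by positivity)
    obtain ⟨⟨z, hzc⟩, hzb⟩ := hL (a', c') ⟨⟨h1, by linarith⟩, ⟨h3, by linarith⟩⟩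
    refine hz z hzc _ _ _ _ (by linarith) (by linarith) (Subset.trans ?_ hzb)
    rintro ⟨s, t⟩ ⟨⟨s1, s2⟩, ⟨t1, t2⟩⟩
    simp only at s1 s2 t1 t2
    rw [Metric.mem_ball, Prod.dist_eq, Real.dist_eq, Real.dist_eq, max_lt_iff, abs_lt, abs_lt]
    refine ⟨⟨?_, ?_⟩, ?_, ?_⟩ <;> simp only <;> linarith

/-- If `[a, b] × [c, d]` is conservative outside `[a', b'] × [c', d']`, then the integrals along
the boundaries of the two rectangles agree. -/
theorem rectIntegral_eq_of_diff_subset (hu : Continuous u) (hv : Continuous v)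
    {a b c d a' b' c' d' : ℝ} (ha : a ≤ a') (hab : a' ≤ b') (hb : b' ≤ b)
    (hc : c ≤ c') (hcd : c' ≤ d') (hd : d' ≤ d)
    (h : (Icc a b ×ˢ Icc c d) \ (Icc a' b' ×ˢ Icc c' d') ⊆ conservativeSet u v) :
    rectIntegral u v a b c d = rectIntegral u v a' b' c' d' := by
  have hout : ∀ s ∈ Icc a b, ∀ t ∈ Icc c d, (s < a' ∨ b' < s ∨ t < c' ∨ d' < t) →
      (s, t) ∈ conservativeSet u v := by
    intro s hs t ht hst
    refine h ⟨⟨hs, ht⟩, fun hmem => ?_⟩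
    obtain ⟨⟨h1, h2⟩, h3, h4⟩ := hmem
    simp only at h1 h2 h3 h4
    rcases hst with hh | hh | hh | hh <;> linarith
  have hL : rectIntegral u v a a' c d = 0 := by
    refine rectIntegral_eq_zero_of_interior hu hv ha fun p q hp hpq hq => ?_
    refine rectIntegral_eq_zero_of_subset_conservativeSet hu hv hpq (by linarith) ?_
    rintro ⟨s, t⟩ ⟨⟨h1, h2⟩, ht⟩
    simp only at h1 h2 ht
    exact hout s ⟨by linarith, by linarith⟩ t ht (Or.inl (by linarith))
  have hR : rectIntegral u v b' b c d = 0 := by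
    refine rectIntegral_eq_zero_of_interior hu hv hb fun p q hp hpq hq => ?_
    refine rectIntegral_eq_zero_of_subset_conservativeSet hu hv hpq (by linarith) ?_
    rintro ⟨s, t⟩ ⟨⟨h1, h2⟩, ht⟩
    simp only at h1 h2 ht
    exact hout s ⟨by linarith, by linarith⟩ t ht (Or.inr (Or.inl (by linarith)))
  -- The lower and upper strips are reduced to the case of vertical strips by exchanging the
  -- coordinates.
  have hus := hu.comp continuous_swap
  have hvs := hv.comp continuous_swap
  have hB : rectIntegral u v a' b' c c' = 0 := by
    rw [← neg_eq_zero, ← rectIntegral_swap]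
    refine rectIntegral_eq_zero_of_interior hvs hus hc fun p q hp hpq hq => ?_
    rw [rectIntegral_swap, neg_eq_zero]
    refine rectIntegral_eq_zero_of_subset_conservativeSet hu hv hab hpq ?_
    rintro ⟨s, t⟩ ⟨⟨h1, h2⟩, h3, h4⟩
    simp only at h1 h2 h3 h4
    exact hout s ⟨by linarith, by linarith⟩ t ⟨by linarith, by linarith⟩
      (Or.inr (Or.inr (Or.inl (by linarith))))
  have hT : rectIntegral u v a' b' d' d = 0 := by
    rw [← neg_eq_zero, ← rectIntegral_swap]
    refine rectIntegral_eq_zero_of_interior hvs hus hd fun p q hp hpq hq => ?_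
    rw [rectIntegral_swap, neg_eq_zero]
    refine rectIntegral_eq_zero_of_subset_conservativeSet hu hv hab hpq ?_
    rintro ⟨s, t⟩ ⟨⟨h1, h2⟩, h3, h4⟩
    simp only at h1 h2 h3 h4
    exact hout s ⟨by linarith, by linarith⟩ t ⟨by linarith, by linarith⟩
      (Or.inr (Or.inr (Or.inr (by linarith))))
  rw [← rectIntegral_add_horizontal hu hv a a' b, ← rectIntegral_add_horizontal hu hv a' b' b,
    ← rectIntegral_add_vertical hu hv a' b' c c' d,
    ← rectIntegral_add_vertical hu hv a' b' c' d' d, hL, hR, hB, hT]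
  ring

end conservativeSet

/-! ### Functions that are Lipschitz along the axes as seen from a point. -/

/-- Near `z`, the increments of `w` from `z` along the axes are bounded by `N` times the step. -/
def AxisLipschitz (w : ℝ × ℝ → ℝ) (N : ℝ≥0) (η : ℝ) (z : ℝ × ℝ) : Prop :=
  ∀ h : ℝ, |h| ≤ η → |w (z.1 + h, z.2) - w z| ≤ N * |h| ∧ |w (z.1, z.2 + h) - w z| ≤ N * |h|

section AxisLipschitz

variable {w : ℝ × ℝ → ℝ} {N : ℝ≥0} {η : ℝ} {z : ℝ × ℝ}

theorem AxisLipschitz.swap (h : AxisLipschitz w N η z) :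
    AxisLipschitz (w ∘ Prod.swap) N η z.swap := fun t ht => (h t ht).symm

theorem AxisLipschitz.left (h : AxisLipschitz w N η z) {x : ℝ} (hx : |x - z.1| ≤ η) :
    |w (x, z.2) - w z| ≤ N * |x - z.1| := by simpa using (h _ hx).1

theorem AxisLipschitz.right (h : AxisLipschitz w N η z) {y : ℝ} (hy : |y - z.2| ≤ η) :
    |w (z.1, y) - w z| ≤ N * |y - z.2| := by simpa using (h _ hy).2

theorem AxisLipschitz.norm_deriv_le (h : AxisLipschitz w N η z) (hη : 0 < η) :
    ‖deriv (fun s => w (s, z.2)) z.1‖ ≤ N := by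
  refine norm_deriv_le_of_lip' N.2 ?_
  filter_upwards [Metric.closedBall_mem_nhds z.1 hη] with x hx
  exact h.left hx

/-- For each fixed step the condition is closed in `z`. Baire's theorem is applied to these sets. -/
theorem isClosed_setOf_axisLipschitz (hw : Continuous w) : IsClosed {z | AxisLipschitz w N η z} := by
  simp only [AxisLipschitz, ofPred_forall, ofPred_and]
  refine isClosed_iInter fun h => isClosed_iInter fun _ => ?_
  exact (isClosed_le (by fun_prop) continuous_const).inter
    (isClosed_le (by fun_prop) continuous_const)

theorem exists_abs_sub_le_of_differentiableAt {g : ℝ → ℝ} {x : ℝ} (hg : DifferentiableAt ℝ g x) :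
    ∃ K : ℝ, ∃ η > 0, ∀ h : ℝ, |h| ≤ η → |g (x + h) - g x| ≤ K * |h| := by
  obtain ⟨K, hK⟩ := hg.isBigO_sub.bound
  obtain ⟨η, hη, hb⟩ := Metric.eventually_nhds_iff.1 hK
  refine ⟨K, η / 2, by positivity, fun h hh => ?_⟩
  have := hb (y := x + h) (by rw [Real.dist_eq]; simp only [add_sub_cancel_left]; linarith)
  simpa using this

/-- Using one number both as Lipschitz constant and as inverse radius makes the condition a
single-parameter one, so countably many closed sets cover. -/
theorem exists_axisLipschitz (h1 : DifferentiableAt ℝ (fun s => w (s, z.2)) z.1)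
    (h2 : DifferentiableAt ℝ (fun t => w (z.1, t)) z.2) :
    ∃ M : ℝ, 0 < M ∧ ∀ N : ℝ≥0, M ≤ N → AxisLipschitz w N (N : ℝ)⁻¹ z := by
  obtain ⟨K₁, η₁, hη₁, hK₁⟩ := exists_abs_sub_le_of_differentiableAt h1
  obtain ⟨K₂, η₂, hη₂, hK₂⟩ := exists_abs_sub_le_of_differentiableAt h2
  refine ⟨max (max K₁ K₂) (max η₁⁻¹ η₂⁻¹), by positivity, fun N hN h hh => ?_⟩
  simp only [max_le_iff] at hN
  obtain ⟨⟨a1, a2⟩, a3, a4⟩ := hN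
  have b1 : (N : ℝ)⁻¹ ≤ η₁ := inv_le_of_inv_le₀ hη₁ a3
  have b2 : (N : ℝ)⁻¹ ≤ η₂ := inv_le_of_inv_le₀ hη₂ a4
  exact ⟨(hK₁ h (hh.trans b1)).trans (by gcongr), (hK₂ h (hh.trans b2)).trans (by gcongr)⟩

end AxisLipschitz

/-- No differentiability is needed: `deriv` takes the value zero where the derivative does not
exist. -/
theorem measurable_deriv_fst {w : ℝ × ℝ → ℝ} (hw : Continuous w) :
    Measurable fun z : ℝ × ℝ => deriv (fun s => w (s, z.2)) z.1 :=
  (measurable_deriv_with_param (f := fun t s => w (s, t))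
    (hw.comp continuous_swap :)).comp measurable_swap

/-- `abs_integral_sub_sub_setIntegral_deriv_le` for a set of points where the function is Lipschitz
along the axes. -/
theorem AxisLipschitz.abs_integral_sub_sub_setIntegral_deriv_le {w : ℝ × ℝ → ℝ}
    {a b c d a' b' c' d' κ η : ℝ} {E : Set (ℝ × ℝ)} {N : ℝ≥0} (hw : Continuous w)
    (hE : IsClosed E) (hER : E ⊆ Icc a' b' ×ˢ Icc c' d')
    (hl : ∃ t, (a', t) ∈ E) (hr : ∃ t, (b', t) ∈ E) (hη : 0 < η)
    (hN : ∀ z ∈ E, AxisLipschitz w N η z)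
    (hd : ∀ z ∈ E, DifferentiableAt ℝ (fun s => w (s, z.2)) z.1)
    (ha : a ≤ a') (hb : b' ≤ b) (hc : c ≤ c') (hd' : d' ≤ d) (hκ : 1 ≤ κ)
    (hκ' : (b - a) + 3 * (d - c) ≤ κ * (b - a)) (hη₁ : b - a ≤ η) (hη₂ : d - c ≤ η) :
    |(∫ t in c'..d', (w (b', t) - w (a', t))) -
        ∫ z in E, deriv (fun s => w (s, z.2)) z.1| ≤
      N * κ * volume.real ((Icc a b ×ˢ Icc c d) \ E) := by
  refine (Monogenic.abs_integral_sub_sub_setIntegral_deriv_le (x₀ := a) (x₁ := b) (κ := κ) hw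
    (measurable_deriv_fst hw) hE hER hl hr ?_ ?_ (fun z hz => (hd z hz).hasDerivAt)
    (fun z hz => (hN z hz).norm_deriv_le hη) ha hb hκ ?_).trans ?_
  · intro z hz x hx
    refine (hN z hz).left ?_
    obtain ⟨⟨h1, h2⟩, -⟩ := hER hz
    rw [abs_le]; constructor <;> linarith [hx.1, hx.2]
  · intro z hz x hx
    refine (hN z hz).right ?_
    obtain ⟨-, h1, h2⟩ := hER hz
    rw [abs_le]; constructor <;> linarith [hx.1, hx.2]
  · linarith
  · gcongr ?_ * ?_
    refine measureReal_mono (sdiff_subset_sdiff_left (prod_mono le_rfl (Icc_subset_Icc hc hd')))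
      (ne_top_of_le_ne_top (isCompact_Icc.prod isCompact_Icc).measure_lt_top.ne
        (measure_mono sdiff_subset))

/-! ### The curl-free Looman–Menchoff theorem. -/

section curlFree

variable {u v : ℝ × ℝ → ℝ}

/-- Shrinking the rectangle to the bounding box of `E` does not change the integral. On the box the
row estimate applies to `v`, and with the coordinates exchanged to `u`; the two integrals over `E`
cancel by `hcurl`, and the two errors give the factor 2. -/
theorem abs_rectIntegral_le (hu : Continuous u) (hv : Continuous v) {a b c d η κ : ℝ} {N : ℝ≥0}
    (hab : a ≤ b) (hcd : c ≤ d) (hη : 0 < η)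
    (hη₁ : b - a ≤ η) (hη₂ : d - c ≤ η) (hκ : 1 ≤ κ)
    (hκ₁ : (b - a) + 3 * (d - c) ≤ κ * (b - a)) (hκ₂ : (d - c) + 3 * (b - a) ≤ κ * (d - c))
    (hNu : ∀ z ∈ (Icc a b ×ˢ Icc c d) \ conservativeSet u v, AxisLipschitz u N η z)
    (hNv : ∀ z ∈ (Icc a b ×ˢ Icc c d) \ conservativeSet u v, AxisLipschitz v N η z)
    (hdu : ∀ z ∈ (Icc a b ×ˢ Icc c d) \ conservativeSet u v,
      DifferentiableAt ℝ (fun t => u (z.1, t)) z.2)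
    (hdv : ∀ z ∈ (Icc a b ×ˢ Icc c d) \ conservativeSet u v,
      DifferentiableAt ℝ (fun s => v (s, z.2)) z.1)
    (hcurl : ∀ z ∈ (Icc a b ×ˢ Icc c d) \ conservativeSet u v,
      deriv (fun s => v (s, z.2)) z.1 = deriv (fun t => u (z.1, t)) z.2) :
    |rectIntegral u v a b c d| ≤
      2 * N * κ * volume.real ((Icc a b ×ˢ Icc c d) ∩ conservativeSet u v) := by
  have hκ0 : 0 ≤ κ := zero_le_one.trans hκ
  set G := conservativeSet u v with hG
  set Q := Icc a b ×ˢ Icc c d with hQ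
  set E := Q \ G with hE
  have hEc : IsCompact E := (isCompact_Icc.prod isCompact_Icc).diff isOpen_conservativeSet
  have hQE : Q \ E = Q ∩ G := by rw [hE, sdiff_sdiff_right_self]
  rcases E.eq_empty_or_nonempty with h0 | hne
  · rw [rectIntegral_eq_zero_of_subset_conservativeSet hu hv hab hcd (sdiff_eq_empty.1 h0), abs_zero]
    positivity
  -- Extreme points of `E` in the four directions: every edge of the bounding box meets `E`, as the
  -- row estimate requires.
  obtain ⟨zl, hzl, hl⟩ := hEc.exists_isMinOn hne continuous_fst.continuousOn
  obtain ⟨zr, hzr, hr⟩ := hEc.exists_isMaxOn hne continuous_fst.continuousOn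
  obtain ⟨zb, hzb, hb⟩ := hEc.exists_isMinOn hne continuous_snd.continuousOn
  obtain ⟨zt, hzt, ht⟩ := hEc.exists_isMaxOn hne continuous_snd.continuousOn
  have hER : E ⊆ Icc zl.1 zr.1 ×ˢ Icc zb.2 zt.2 := fun z hz =>
    ⟨⟨hl hz, hr hz⟩, hb hz, ht hz⟩
  have hEs : IsClosed (Prod.swap ⁻¹' E) := hEc.isClosed.preimage continuous_swap
  rw [rectIntegral_eq_of_diff_subset hu hv hzl.1.1.1 (hl hzr) hzr.1.1.2 hzb.1.2.1 (hb hzt)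
    hzt.1.2.2 (fun z hz => by
      by_contra hzG
      exact hz.2 (hER ⟨hz.1, hzG⟩))]
  have h1 := AxisLipschitz.abs_integral_sub_sub_setIntegral_deriv_le (κ := κ) hv hEc.isClosed hER
    ⟨zl.2, hzl⟩ ⟨zr.2, hzr⟩ hη hNv hdv hzl.1.1.1 hzr.1.1.2 hzb.1.2.1 hzt.1.2.2 hκ hκ₁ hη₁ hη₂
  have h2 := AxisLipschitz.abs_integral_sub_sub_setIntegral_deriv_le (κ := κ)
    (hu.comp continuous_swap) hEs (fun z hz => ⟨(hER hz).2, (hER hz).1⟩)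
    ⟨zb.1, hzb⟩ ⟨zt.1, hzt⟩ hη (fun z hz => (hNu _ hz).swap) (fun z hz => hdu _ hz)
    hzb.1.2.1 hzt.1.2.2 hzl.1.1.1 hzr.1.1.2 hκ hκ₂ hη₂ hη₁
  have hswap : MeasurePreserving (Prod.swap : ℝ × ℝ → ℝ × ℝ) volume volume :=
    Measure.measurePreserving_swap
  have e1 : ∫ z in Prod.swap ⁻¹' E, deriv (fun s => (u ∘ Prod.swap) (s, z.2)) z.1 =
      ∫ z in E, deriv (fun s => v (s, z.2)) z.1 := by
    rw [setIntegral_congr_fun hEc.measurableSet hcurl]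
    exact hswap.setIntegral_preimage_emb MeasurableEquiv.prodComm.measurableEmbedding
      (fun z => deriv (fun t => u (z.1, t)) z.2) E
  have e2 : volume.real ((Icc c d ×ˢ Icc a b) \ Prod.swap ⁻¹' E) = volume.real (Q \ E) := by
    have : (Icc c d ×ˢ Icc a b) \ Prod.swap ⁻¹' E = Prod.swap ⁻¹' (Q \ E) := by
      ext z
      simp only [hQ, Set.mem_sdiff, mem_preimage, mem_prod, Prod.fst_swap, Prod.snd_swap]
      tauto
    rw [this, measureReal_def, measureReal_def, hswap.measure_preimage_emb
      MeasurableEquiv.prodComm.measurableEmbedding]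
  rw [e1, e2] at h2
  simp only [Function.comp_apply, Prod.swap_prod_mk] at h2
  rw [hQE] at h1 h2
  unfold rectIntegral
  rw [abs_le] at *
  constructor <;> linarith [h1.1, h1.2, h2.1, h2.2]

end curlFree

section

variable {u v : ℝ × ℝ → ℝ}

/-- Half-open rectangles make the halves disjoint, so the area bound is exactly additive under
subdivision. -/
theorem measureReal_Ioc_prod_Ioc_inter_add {S : Set (ℝ × ℝ)} (hS : MeasurableSet S)
    {a m b : ℝ} (c d : ℝ) (ham : a ≤ m) (hmb : m ≤ b) :
    volume.real ((Ioc a m ×ˢ Ioc c d) ∩ S) + volume.real ((Ioc m b ×ˢ Ioc c d) ∩ S) =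
      volume.real ((Ioc a b ×ˢ Ioc c d) ∩ S) := by
  have hfin : ∀ p q : ℝ, volume ((Ioc p q ×ˢ Ioc c d) ∩ S) ≠ ⊤ := fun p q =>
    ne_top_of_le_ne_top (isCompact_Icc.prod isCompact_Icc).measure_lt_top.ne
      (measure_mono (inter_subset_left.trans (prod_mono Ioc_subset_Icc_self Ioc_subset_Icc_self)))
  rw [← measureReal_union ?_ ((measurableSet_Ioc.prod measurableSet_Ioc).inter hS)
    (hfin _ _) (hfin _ _), ← union_inter_distrib_right, ← union_prod, Ioc_union_Ioc_eq_Ioc ham hmb]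
  rw [Set.disjoint_left]
  rintro z ⟨⟨h1, -⟩, -⟩ ⟨⟨h2, -⟩, -⟩
  exact absurd h1.2 (not_le.2 h2.1)

theorem measureReal_Ioc_prod_Ioc_inter_add' {S : Set (ℝ × ℝ)} (hS : MeasurableSet S)
    (a b : ℝ) {c m d : ℝ} (hcm : c ≤ m) (hmd : m ≤ d) :
    volume.real ((Ioc a b ×ˢ Ioc c m) ∩ S) + volume.real ((Ioc a b ×ˢ Ioc m d) ∩ S) =
      volume.real ((Ioc a b ×ˢ Ioc c d) ∩ S) := by
  have hfin : ∀ p q : ℝ, volume ((Ioc a b ×ˢ Ioc p q) ∩ S) ≠ ⊤ := fun p q =>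
    ne_top_of_le_ne_top (isCompact_Icc.prod isCompact_Icc).measure_lt_top.ne
      (measure_mono (inter_subset_left.trans (prod_mono Ioc_subset_Icc_self Ioc_subset_Icc_self)))
  rw [← measureReal_union ?_ ((measurableSet_Ioc.prod measurableSet_Ioc).inter hS)
    (hfin _ _) (hfin _ _), ← union_inter_distrib_right, ← prod_union, Ioc_union_Ioc_eq_Ioc hcm hmd]
  rw [Set.disjoint_left]
  rintro z ⟨⟨-, h1⟩, -⟩ ⟨⟨-, h2⟩, -⟩
  exact absurd h1.2 (not_le.2 h2.1)

/-- A cell of diameter at most `δ` that meets `E` lies in the `δ`-thickening of `E`, and the other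
cells contribute nothing. The sum of the cell errors is thus controlled by the area of the
thickening outside `E`, which tends to zero because `E` is compact. -/
theorem rectIntegral_eq_zero_of_axisLipschitz (hu : Continuous u) (hv : Continuous v)
    {A B C D η : ℝ} {N : ℝ≥0} (hAB : A ≤ B) (hCD : C ≤ D) (hη : 0 < η)
    (hη₁ : B - A ≤ η) (hη₂ : D - C ≤ η)
    (hNu : ∀ z ∈ (Icc A B ×ˢ Icc C D) \ conservativeSet u v, AxisLipschitz u N η z)
    (hNv : ∀ z ∈ (Icc A B ×ˢ Icc C D) \ conservativeSet u v, AxisLipschitz v N η z)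
    (hdu : ∀ z ∈ (Icc A B ×ˢ Icc C D) \ conservativeSet u v,
      DifferentiableAt ℝ (fun t => u (z.1, t)) z.2)
    (hdv : ∀ z ∈ (Icc A B ×ˢ Icc C D) \ conservativeSet u v,
      DifferentiableAt ℝ (fun s => v (s, z.2)) z.1)
    (hcurl : ∀ z ∈ (Icc A B ×ˢ Icc C D) \ conservativeSet u v,
      deriv (fun s => v (s, z.2)) z.1 = deriv (fun t => u (z.1, t)) z.2) :
    rectIntegral u v A B C D = 0 := by
  rcases hAB.eq_or_lt with rfl | hAB'
  · simp [rectIntegral]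
  rcases hCD.eq_or_lt with rfl | hCD'
  · simp [rectIntegral]
  have hw : 0 < B - A := by linarith
  have hh : 0 < D - C := by linarith
  -- This depends only on the ratio of the sides, so it serves every dyadic cell.
  set κ : ℝ := 1 + 3 * ((D - C) / (B - A) + (B - A) / (D - C)) with hκ
  have hκ1 : 1 ≤ κ := by rw [hκ]; linarith [div_pos hw hh, div_pos hh hw]
  have hκw : (B - A) + 3 * (D - C) ≤ κ * (B - A) := by
    have : κ * (B - A) = (B - A) + 3 * (D - C) + 3 * ((B - A) / (D - C) * (B - A)) := by
      rw [hκ]; field_simp; ring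
    rw [this]
    have : 0 ≤ (B - A) / (D - C) * (B - A) := by positivity
    linarith
  have hκh : (D - C) + 3 * (B - A) ≤ κ * (D - C) := by
    have : κ * (D - C) = (D - C) + 3 * (B - A) + 3 * ((D - C) / (B - A) * (D - C)) := by
      rw [hκ]; field_simp; ring
    rw [this]
    have : 0 ≤ (D - C) / (B - A) * (D - C) := by positivity
    linarith
  set G := conservativeSet u v with hG
  set E := (Icc A B ×ˢ Icc C D) \ G with hE
  have hEc : IsCompact E := (isCompact_Icc.prod isCompact_Icc).diff isOpen_conservativeSet
  set K : ℝ := 2 * N * κ with hK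
  have hK0 : 0 ≤ K := by positivity
  have key : ∀ δ > 0, |rectIntegral u v A B C D| ≤
      K * (volume.real (Metric.cthickening δ E) - volume.real E) := by
    intro δ hδ
    have hTfin : volume (Metric.cthickening δ E) ≠ ⊤ := hEc.cthickening.measure_lt_top.ne
    set S := Metric.cthickening δ E ∩ G with hS
    have hSm : MeasurableSet S :=
      Metric.isClosed_cthickening.measurableSet.inter isOpen_conservativeSet.measurableSet
    obtain ⟨n, hn1, hn2⟩ := exists_div_two_pow_lt (B - A) (D - C) hδ
    have hmain : |rectIntegral u v A B C D| ≤
        K * volume.real ((Ioc A B ×ˢ Ioc C D) ∩ S) := by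
      refine rect_induction (F := fun a b c d => |rectIntegral u v a b c d| ≤
        K * volume.real ((Ioc a b ×ˢ Ioc c d) ∩ S)) ?_ ?_ hAB hCD n ?_
      · intro a m b c d h1 h2 _ h3 h4
        rw [← rectIntegral_add_horizontal hu hv a m b,
          ← measureReal_Ioc_prod_Ioc_inter_add hSm c d h1 h2, mul_add]
        exact (abs_add_le _ _).trans (add_le_add h3 h4)
      · intro a b c m d _ h1 h2 h3 h4
        rw [← rectIntegral_add_vertical hu hv a b c m,
          ← measureReal_Ioc_prod_Ioc_inter_add' hSm a b h1 h2, mul_add]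
        exact (abs_add_le _ _).trans (add_le_add h3 h4)
      · intro a c ha ha' hc hc'
        have q1 : (1 : ℝ) ≤ 2 ^ n := one_le_pow₀ one_le_two
        have p1 : 0 < (B - A) / 2 ^ n := by positivity
        have p2 : 0 < (D - C) / 2 ^ n := by positivity
        have r1 : (B - A) / 2 ^ n ≤ B - A := div_le_self hw.le q1
        have r2 : (D - C) / 2 ^ n ≤ D - C := div_le_self hh.le q1
        set b := a + (B - A) / 2 ^ n with hb
        set d := c + (D - C) / 2 ^ n with hd
        have hbw : b - a = (B - A) / 2 ^ n := by rw [hb]; ring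
        have hdh : d - c = (D - C) / 2 ^ n := by rw [hd]; ring
        have hab : a ≤ b := by linarith
        have hcd : c ≤ d := by linarith
        have hQ : (Icc a b ×ˢ Icc c d) ⊆ Icc A B ×ˢ Icc C D :=
          prod_mono (Icc_subset_Icc ha ha') (Icc_subset_Icc hc hc')
        have hQE : (Icc a b ×ˢ Icc c d) \ G ⊆ E := sdiff_subset_sdiff_left hQ
        rcases ((Icc a b ×ˢ Icc c d) \ G).eq_empty_or_nonempty with h0 | ⟨e, he⟩
        · rw [rectIntegral_eq_zero_of_subset_conservativeSet hu hv hab hcd (sdiff_eq_empty.1 h0),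
            abs_zero]
          positivity
        have hb1 := abs_rectIntegral_le (N := N) (κ := κ) hu hv hab hcd hη
          (by linarith) (by linarith) hκ1
          (by
            rw [hbw, hdh, ← mul_div_assoc, ← mul_div_assoc, ← add_div]; gcongr)
          (by
            rw [hbw, hdh, ← mul_div_assoc, ← mul_div_assoc, ← add_div]; gcongr)
          (fun z hz => hNu z (hQE hz)) (fun z hz => hNv z (hQE hz)) (fun z hz => hdu z (hQE hz))
          (fun z hz => hdv z (hQE hz)) (fun z hz => hcurl z (hQE hz))
        refine hb1.trans (mul_le_mul_of_nonneg_left ?_ hK0)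
        have hsub : (Icc a b ×ˢ Icc c d) ∩ G ⊆ (Icc a b ×ˢ Icc c d) ∩ S := by
          rintro z ⟨hz, hzG⟩
          refine ⟨hz, Metric.mem_cthickening_of_dist_le z e δ E (hQE he) ?_, hzG⟩
          have he1 := he.1
          rw [Prod.dist_eq, Real.dist_eq, Real.dist_eq, max_le_iff, abs_le, abs_le]
          refine ⟨⟨?_, ?_⟩, ?_, ?_⟩ <;>
            linarith [hz.1.1, hz.1.2, hz.2.1, hz.2.2, he1.1.1, he1.1.2, he1.2.1, he1.2.2]
        have hae : ((Ioc a b ×ˢ Ioc c d) ∩ S : Set (ℝ × ℝ)) =ᵐ[volume]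
            ((Icc a b ×ˢ Icc c d) ∩ S : Set (ℝ × ℝ)) :=
          (Measure.set_prod_ae_eq Ioc_ae_eq_Icc Ioc_ae_eq_Icc).inter (ae_eq_refl _)
        rw [measureReal_congr hae]
        exact measureReal_mono hsub (ne_top_of_le_ne_top
          (isCompact_Icc.prod isCompact_Icc).measure_lt_top.ne (measure_mono inter_subset_left))
    refine hmain.trans (mul_le_mul_of_nonneg_left ?_ hK0)
    have hEsub : E ⊆ Metric.cthickening δ E := Metric.self_subset_cthickening E
    rw [← measureReal_sdiff hEsub hEc.measurableSet hTfin]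
    refine measureReal_mono ?_ (ne_top_of_le_ne_top hTfin (measure_mono sdiff_subset))
    rintro z ⟨-, hz1, hz2⟩
    exact ⟨hz1, fun h => h.2 hz2⟩
  have hlim : Tendsto (fun δ => K * (volume.real (Metric.cthickening δ E) - volume.real E))
      (𝓝[>] 0) (𝓝 0) := by
    have h1 : Tendsto (fun δ => volume.real (Metric.cthickening δ E)) (𝓝 0)
        (𝓝 (volume.real E)) :=
      (ENNReal.tendsto_toReal hEc.measure_lt_top.ne).comp
        (tendsto_measure_cthickening_of_isCompact hEc)
    have h2 := (h1.sub_const (volume.real E)).const_mul K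
    rw [sub_self, mul_zero] at h2
    exact h2.mono_left nhdsWithin_le_nhds
  have := ge_of_tendsto hlim (eventually_mem_nhdsWithin.mono fun δ hδ => key δ hδ)
  exact abs_eq_zero.1 (le_antisymm this (abs_nonneg _))

/-- A curl-free version of the Looman–Menchoff theorem. -/
theorem subset_conservativeSet (hu : Continuous u) (hv : Continuous v) {O : Set (ℝ × ℝ)}
    (hO : IsOpen O)
    (hu₁ : ∀ z ∈ O, DifferentiableAt ℝ (fun s => u (s, z.2)) z.1)
    (hu₂ : ∀ z ∈ O, DifferentiableAt ℝ (fun t => u (z.1, t)) z.2)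
    (hv₁ : ∀ z ∈ O, DifferentiableAt ℝ (fun s => v (s, z.2)) z.1)
    (hv₂ : ∀ z ∈ O, DifferentiableAt ℝ (fun t => v (z.1, t)) z.2)
    (hcurl : ∀ z ∈ O, deriv (fun s => v (s, z.2)) z.1 = deriv (fun t => u (z.1, t)) z.2) :
    O ⊆ conservativeSet u v := by
  rw [← sdiff_eq_empty]
  by_contra hne
  rw [← Ne, ← nonempty_iff_ne_empty] at hne
  set P := O \ conservativeSet u v with hP
  -- `P` is open intersected with closed, hence a `Gδ` in the plane and a Baire space.
  have hGδ : IsGδ P := hO.isGδ.inter isOpen_conservativeSet.isClosed_compl.isGδ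
  have : BaireSpace P := hGδ.baireSpace_of_t2Space_locallyCompactSpace
  have : Nonempty P := hne.to_subtype
  -- The shift to `n + 1` keeps the radius positive.
  let f : ℕ → Set P := fun n => {z | AxisLipschitz u (n + 1) ((n + 1 : ℝ≥0) : ℝ)⁻¹ z ∧
    AxisLipschitz v (n + 1) ((n + 1 : ℝ≥0) : ℝ)⁻¹ z}
  have hf : ∀ n, IsClosed (f n) := fun n =>
    ((isClosed_setOf_axisLipschitz hu).inter (isClosed_setOf_axisLipschitz hv)).preimage
      continuous_subtype_val
  have hcov : ⋃ n, f n = univ := by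
    refine eq_univ_of_forall fun z => ?_
    obtain ⟨M₁, -, h1⟩ := exists_axisLipschitz (hu₁ z z.2.1) (hu₂ z z.2.1)
    obtain ⟨M₂, -, h2⟩ := exists_axisLipschitz (hv₁ z z.2.1) (hv₂ z z.2.1)
    obtain ⟨n, hn⟩ := exists_nat_ge (max M₁ M₂)
    rw [max_le_iff] at hn
    have hn' : (n : ℝ) ≤ ((n + 1 : ℝ≥0) : ℝ) := by push_cast; linarith
    exact mem_iUnion.2 ⟨n, h1 _ (hn.1.trans hn'), h2 _ (hn.2.trans hn')⟩
  obtain ⟨n, p, hp⟩ := nonempty_interior_of_iUnion_of_closed hf hcov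
  rw [mem_interior_iff_mem_nhds, Metric.mem_nhds_iff] at hp
  obtain ⟨ε, hε, hball⟩ := hp
  obtain ⟨r, hr, hrO⟩ := Metric.isOpen_iff.1 hO p p.2.1
  have hη : (0 : ℝ) < ((n + 1 : ℝ≥0) : ℝ)⁻¹ := by positivity
  -- The three radii keep points of `P` in `f n`, keep rectangles in `O`, and bound their sides by
  -- the Lipschitz radius; the half accounts for two distances to `p`.
  refine p.2.2 ⟨min (min ε r) (((n + 1 : ℝ≥0) : ℝ)⁻¹ / 2), by positivity, fun a b c d hab hcd hsub => ?_⟩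
  have hdist : ∀ z ∈ Icc a b ×ˢ Icc c d, dist z p < min (min ε r) (((n + 1 : ℝ≥0) : ℝ)⁻¹ / 2) :=
    fun z hz => hsub hz
  simp only [lt_min_iff] at hdist
  have hPE : ∀ z ∈ (Icc a b ×ˢ Icc c d) \ conservativeSet u v, z ∈ P := fun z hz =>
    ⟨hrO (hdist z hz.1).1.2, hz.2⟩
  have hfn : ∀ z (hz : z ∈ (Icc a b ×ˢ Icc c d) \ conservativeSet u v),
      (⟨z, hPE z hz⟩ : P) ∈ f n := fun z hz => hball (hdist z hz.1).1.1
  have h1 := (hdist (a, c) ⟨⟨le_rfl, hab⟩, le_rfl, hcd⟩).2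
  have h2 := (hdist (b, d) ⟨⟨hab, le_rfl⟩, hcd, le_rfl⟩).2
  rw [Prod.dist_eq, Real.dist_eq, Real.dist_eq, max_lt_iff, abs_lt, abs_lt] at h1 h2
  simp only at h1 h2
  refine rectIntegral_eq_zero_of_axisLipschitz (N := n + 1) hu hv hab hcd hη
    (by linarith [h1.1.1, h2.1.2]) (by linarith [h1.2.1, h2.2.2])
    (fun z hz => (hfn z hz).1) (fun z hz => (hfn z hz).2)
    (fun z hz => hu₂ z (hPE z hz).1) (fun z hz => hv₁ z (hPE z hz).1)
    (fun z hz => hcurl z (hPE z hz).1)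

theorem rectIntegral_eq_zero_of_deriv_eq (hu : Continuous u) (hv : Continuous v) {O : Set (ℝ × ℝ)}
    (hO : IsOpen O)
    (hu₁ : ∀ z ∈ O, DifferentiableAt ℝ (fun s => u (s, z.2)) z.1)
    (hu₂ : ∀ z ∈ O, DifferentiableAt ℝ (fun t => u (z.1, t)) z.2)
    (hv₁ : ∀ z ∈ O, DifferentiableAt ℝ (fun s => v (s, z.2)) z.1)
    (hv₂ : ∀ z ∈ O, DifferentiableAt ℝ (fun t => v (z.1, t)) z.2)
    (hcurl : ∀ z ∈ O, deriv (fun s => v (s, z.2)) z.1 = deriv (fun t => u (z.1, t)) z.2)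
    {a b c d : ℝ} (hab : a ≤ b) (hcd : c ≤ d) (hsub : Icc a b ×ˢ Icc c d ⊆ O) :
    rectIntegral u v a b c d = 0 :=
  rectIntegral_eq_zero_of_subset_conservativeSet hu hv hab hcd
    (hsub.trans (subset_conservativeSet hu hv hO hu₁ hu₂ hv₁ hv₂ hcurl))

end

/-! ### Gateaux-closed forms and small triangles. -/

section

variable {V : Type*} [NormedAddCommGroup V] [NormedSpace ℝ V]

/-- A continuous 1-form whose directional derivatives exist and are given by symmetric bilinear
forms. -/
structure IsGateauxClosedOn (ω : V → V →L[ℝ] ℝ) (W : Set V) : Prop where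
  continuousOn : ContinuousOn ω W
  hasLineDerivAt : ∀ x ∈ W, ∃ B : V →ₗ[ℝ] V →ₗ[ℝ] ℝ, (∀ h h', B h h' = B h' h) ∧
    ∀ h h', HasLineDerivAt ℝ (fun y => ω y h') (B h h') x h

/-- The integral of a 1-form along a segment. -/
def segmentIntegral (ω : V → V →L[ℝ] ℝ) (x y : V) : ℝ :=
  ∫ τ in (0 : ℝ)..1, ω (x + τ • (y - x)) (y - x)

@[simp] theorem segmentIntegral_self (ω : V → V →L[ℝ] ℝ) (x : V) : segmentIntegral ω x x = 0 := by
  simp [segmentIntegral]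

theorem segmentIntegral_congr {ω ω' : V → V →L[ℝ] ℝ} {S : Set V} (hS : Convex ℝ S)
    (h : EqOn ω ω' S) {x y : V} (hx : x ∈ S) (hy : y ∈ S) :
    segmentIntegral ω x y = segmentIntegral ω' x y := by
  refine intervalIntegral.integral_congr fun τ hτ => ?_
  rw [uIcc_of_le zero_le_one] at hτ
  rw [h (hS.add_smul_sub_mem hx hy hτ)]

/-- The integral of a form along the boundary of a triangle, as the integral of its pull-back along
the boundary of the square `[0, 1] × [0, 1]`. -/
theorem rectIntegral_cone (ω : V → V →L[ℝ] ℝ) (hω : Continuous ω) (x y z : V) :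
    rectIntegral (fun s => ω (x + s.1 • ((y - x) + s.2 • (z - y))) ((y - x) + s.2 • (z - y)))
        (fun s => s.1 * ω (x + s.1 • ((y - x) + s.2 • (z - y))) (z - y)) 0 1 0 1 =
      segmentIntegral ω x y + segmentIntegral ω y z - segmentIntegral ω x z := by
  unfold rectIntegral segmentIntegral
  rw [intervalIntegral.integral_sub (f := fun s : ℝ =>
      ω (x + s • ((y - x) + (1 : ℝ) • (z - y))) ((y - x) + (1 : ℝ) • (z - y)))
    (Continuous.intervalIntegrable (by fun_prop) _ _)
    (Continuous.intervalIntegrable (by fun_prop) _ _)]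
  have h : ∀ t : ℝ, x + (y - x + t • (z - y)) = y + t • (z - y) := fun t => by abel
  simp only [one_smul, one_mul, zero_mul, zero_smul, add_zero, sub_zero, h, sub_add_sub_cancel']
  ring

/-- On the unit square the pull-back by the cone map `(s, t) ↦ x + s (p + t q)` is curl-free, and
its boundary integral is that of the triangle. -/
theorem IsGateauxClosedOn.segmentIntegral_add [FiniteDimensional ℝ V] {ω : V → V →L[ℝ] ℝ}
    {W : Set V} (hω : IsGateauxClosedOn ω W) {x₀ : V} {r : ℝ} (hr : Metric.closedBall x₀ r ⊆ W)
    {x y z : V} (hx : x ∈ Metric.ball x₀ r) (hy : y ∈ Metric.ball x₀ r)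
    (hz : z ∈ Metric.ball x₀ r) :
    segmentIntegral ω x y + segmentIntegral ω y z = segmentIntegral ω x z := by
  -- Tietze extension: the rectangle theorems ask for coefficients continuous on the whole plane.
  obtain ⟨g, hg⟩ := ContinuousMap.exists_restrict_eq (Y := V →L[ℝ] ℝ)
    (Metric.isClosed_closedBall (x := x₀) (ε := r))
    ⟨(Metric.closedBall x₀ r).domRestrict ω, (hω.continuousOn.mono hr).domRestrict⟩
  have hgc : Continuous g := g.continuous
  have hgω : EqOn ω g (Metric.ball x₀ r) := fun a ha =>
    (DFunLike.congr_fun hg ⟨a, Metric.ball_subset_closedBall ha⟩).symm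
  have hder : ∀ a ∈ Metric.ball x₀ r, ∃ B : V →ₗ[ℝ] V →ₗ[ℝ] ℝ, (∀ h h', B h h' = B h' h) ∧
      ∀ (h h' b : V) (s : ℝ), b + s • h = a →
        HasDerivAt (fun s => g (b + s • h) h') (B h h') s := by
    intro a ha
    obtain ⟨B, hB, hd⟩ := hω.hasLineDerivAt a (hr (Metric.ball_subset_closedBall ha))
    refine ⟨B, hB, fun h h' b s hbs => ?_⟩
    have h1 : HasDerivAt (fun t : ℝ => ω (a + t • h) h') (B h h') (s - s) := by
      rw [sub_self]; exact hd h h'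
    have h2 := h1.comp_sub_const s s
    have hnear : ∀ᶠ t : ℝ in 𝓝 s, b + t • h ∈ Metric.ball x₀ r := by
      have hc : Continuous fun t : ℝ => b + t • h := by fun_prop
      exact hc.continuousAt.eventually_mem (Metric.isOpen_ball.mem_nhds (by rwa [hbs]))
    refine h2.congr_of_eventuallyEq (hnear.mono fun t ht => ?_)
    have : a + (t - s) • h = b + t • h := by rw [← hbs, sub_smul]; abel
    dsimp only
    rw [this, hgω ht]
  have hconv := convex_ball x₀ r
  set p := y - x with hp
  set q := z - y with hq
  set O : Set (ℝ × ℝ) := (fun s : ℝ × ℝ => x + s.1 • (p + s.2 • q)) ⁻¹' Metric.ball x₀ r with hO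
  -- The repeated `d₂` is the curl condition. Both cross derivatives equal `ω q + s B(p, q) + s t
  -- B(q, q)`, once `B(q, p) = B(p, q)` is used.
  have hpart : ∀ σ ∈ O, ∃ d₁ d₂ d₃ : ℝ,
      HasDerivAt (fun s => g (x + s • (p + σ.2 • q)) (p + σ.2 • q)) d₁ σ.1 ∧
      HasDerivAt (fun t => g (x + σ.1 • (p + t • q)) (p + t • q)) d₂ σ.2 ∧
      HasDerivAt (fun s => s * g (x + s • (p + σ.2 • q)) q) d₂ σ.1 ∧
      HasDerivAt (fun t => σ.1 * g (x + σ.1 • (p + t • q)) q) d₃ σ.2 := by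
    rintro ⟨s, t⟩ hσ
    obtain ⟨B, hB, hd⟩ := hder _ hσ
    have hb : (x + s • p) + t • s • q = x + s • (p + t • q) := by
      rw [smul_add, smul_comm t s, add_assoc]
    have hv : ∀ h', HasDerivAt (fun t => g (x + s • (p + t • q)) h') (B (s • q) h') t := by
      intro h'
      refine (hd (s • q) h' (x + s • p) t hb).congr_of_eventuallyEq
        (Eventually.of_forall fun t' => ?_)
      dsimp only
      rw [smul_add, smul_comm s t', add_assoc]
    have h2 := (hv p).add ((hasDerivAt_id t).mul (hv q))
    have h3 := (hasDerivAt_id s).mul (hd (p + t • q) q x s rfl)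
    refine ⟨_, _, _, hd _ _ x s rfl, h2.congr_of_eventuallyEq (Eventually.of_forall fun t' => ?_),
      h3.congr_deriv ?_, (hv q).const_mul s⟩
    · simp
    · simp [hB p q]
      ring
  have hzero := rectIntegral_cone g hgc x y z
  rw [rectIntegral_eq_zero_of_deriv_eq (O := O) (by fun_prop) (by fun_prop)
      (Metric.isOpen_ball.preimage (by fun_prop)) ?_ ?_ ?_ ?_ ?_ zero_le_one zero_le_one ?_] at hzero
  · rw [segmentIntegral_congr hconv hgω hx hy, segmentIntegral_congr hconv hgω hy hz,
      segmentIntegral_congr hconv hgω hx hz]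
    linarith
  · intro σ hσ
    obtain ⟨_, _, _, h, -⟩ := hpart σ hσ
    exact h.differentiableAt
  · intro σ hσ
    obtain ⟨_, _, _, -, h, -⟩ := hpart σ hσ
    exact h.differentiableAt
  · intro σ hσ
    obtain ⟨_, _, _, -, -, h, -⟩ := hpart σ hσ
    exact h.differentiableAt
  · intro σ hσ
    obtain ⟨_, _, _, -, -, -, h⟩ := hpart σ hσ
    exact h.differentiableAt
  · intro σ hσ
    obtain ⟨_, _, _, -, h, h', -⟩ := hpart σ hσ
    exact h'.deriv.trans h.deriv.symm
  · rintro ⟨s, t⟩ ⟨hs, ht⟩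
    have h1 := hconv.add_smul_sub_mem hy hz ht
    have h2 := hconv.add_smul_sub_mem hx h1 hs
    have : y + t • (z - y) - x = p + t • q := by rw [hp, hq]; abel
    rwa [this] at h2

end

/-! ### Homotopy invariance along fine grids. -/

section

variable {V : Type*} [NormedAddCommGroup V] [NormedSpace ℝ V]

theorem IsGateauxClosedOn.exists_segmentIntegral_add [FiniteDimensional ℝ V] {ω : V → V →L[ℝ] ℝ}
    {W : Set V} (hω : IsGateauxClosedOn ω W) (hW : IsOpen W) {K : Set V} (hK : IsCompact K)
    (hKW : K ⊆ W) :
    ∃ δ > 0, ∀ p ∈ K, ∀ x ∈ Metric.ball p δ, ∀ y ∈ Metric.ball p δ, ∀ z ∈ Metric.ball p δ,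
      segmentIntegral ω x y + segmentIntegral ω y z = segmentIntegral ω x z := by
  have h : ∀ x ∈ W, ∃ r > 0, Metric.closedBall x r ⊆ W := fun x hx =>
    Metric.nhds_basis_closedBall.mem_iff.1 (hW.mem_nhds hx)
  choose! r hr hrW using h
  obtain ⟨δ, hδ, hL⟩ := lebesgue_number_lemma_of_metric (ι := W)
    (c := fun x => Metric.ball (x : V) (r x)) hK (fun _ => Metric.isOpen_ball)
    (fun x hx => mem_iUnion.2 ⟨⟨x, hKW hx⟩, Metric.mem_ball_self (hr x (hKW hx))⟩)
  refine ⟨δ, hδ, fun p hp x hx y hy z hz => ?_⟩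
  obtain ⟨⟨c, hc⟩, hsub⟩ := hL p hp
  exact hω.segmentIntegral_add (hrW c hc) (hsub hx) (hsub hy) (hsub hz)

/-- The integrals of a closed form along the fine inscribed polygons of a null-homotopic loop
vanish. -/
theorem IsGateauxClosedOn.eventually_sum_segmentIntegral_eq_zero [FiniteDimensional ℝ V]
    {ω : V → V →L[ℝ] ℝ} {W : Set V} (hω : IsGateauxClosedOn ω W) (hW : IsOpen W)
    (γ : C(UnitAddCircle, W)) (hγ : γ.Nullhomotopic) :
    ∀ᶠ n : ℕ in atTop, ∑ j ∈ Finset.range n,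
      segmentIntegral ω (γ (((j / n : ℝ)) : UnitAddCircle) : V)
        (γ ((((j + 1 : ℕ) / n : ℝ)) : UnitAddCircle) : V) = 0 := by
  obtain ⟨w, ⟨H⟩⟩ := hγ
  let X : ℝ × ℝ → V := fun s => H (projIcc 0 1 zero_le_one s.1, (s.2 : UnitAddCircle))
  have hX : Continuous X := by
    have : Continuous fun s : ℝ × ℝ =>
        ((projIcc 0 1 zero_le_one s.1 : unitInterval), (s.2 : UnitAddCircle)) :=
      (continuous_projIcc.comp continuous_fst).prodMk
        ((AddCircle.continuous_mk' (1 : ℝ)).comp continuous_snd)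
    exact continuous_subtype_val.comp (H.continuous.comp this)
  have hX0 : ∀ t, X (0, t) = γ (t : UnitAddCircle) := fun t => by
    simp only [X, projIcc_left]
    exact congrArg Subtype.val (H.map_zero_left _)
  have hX1 : ∀ t, X (1, t) = w := fun t => by
    simp only [X, projIcc_right]
    exact congrArg Subtype.val (H.map_one_left _)
  have hXper : ∀ s, X (s, 0) = X (s, 1) := fun s => by
    have : ((1 : ℝ) : UnitAddCircle) = ((0 : ℝ) : UnitAddCircle) := by
      simp
    simp only [X, this]
  have hXW : ∀ s, X s ∈ W := fun s => Subtype.coe_prop _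
  have hI : IsCompact (Icc (0 : ℝ) 1 ×ˢ Icc (0 : ℝ) 1) := isCompact_Icc.prod isCompact_Icc
  obtain ⟨δ, hδ, hco⟩ := hω.exists_segmentIntegral_add hW (hI.image hX)
    (by rintro _ ⟨s, -, rfl⟩; exact hXW s)
  obtain ⟨η, hη, hunif⟩ := Metric.uniformContinuousOn_iff.1
    (hI.uniformContinuousOn_of_continuous hX.continuousOn) δ hδ
  have hlim : Tendsto (fun n : ℕ => (1 : ℝ) / n) atTop (𝓝 0) := tendsto_one_div_atTop_nhds_zero_nat
  filter_upwards [hlim.eventually_lt_const hη, eventually_gt_atTop 0] with n hn hn0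
  have hnR : (0 : ℝ) < n := by exact_mod_cast hn0
  let x : ℕ → ℕ → V := fun i j => X ((i : ℝ) / n, (j : ℝ) / n)
  have hmem : ∀ i : ℕ, i ≤ n → (i : ℝ) / n ∈ Icc (0 : ℝ) 1 := fun i hi =>
    ⟨by positivity, (div_le_one hnR).2 (by exact_mod_cast hi)⟩
  have hstep : ∀ i i' : ℕ, (i' = i ∨ i' = i + 1) → dist ((i' : ℝ) / n) ((i : ℝ) / n) < η := by
    rintro i i' (rfl | rfl)
    · simpa using hη
    · have : ((i + 1 : ℕ) : ℝ) / n - (i : ℝ) / n = 1 / n := by push_cast; ring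
      rw [Real.dist_eq, this, abs_of_pos (by positivity)]
      exact hn
  have hball : ∀ i j i' j', i + 1 ≤ n → j + 1 ≤ n → (i' = i ∨ i' = i + 1) →
      (j' = j ∨ j' = j + 1) → x i' j' ∈ Metric.ball (x i j) δ := by
    intro i j i' j' hi hj hi' hj'
    refine hunif _ ⟨hmem i' (by omega), hmem j' (by omega)⟩ _
      ⟨hmem i (by omega), hmem j (by omega)⟩ ?_
    exact max_lt (hstep i i' hi') (hstep j j' hj')
  -- On each cell the two triangle identities turn the difference of the horizontal edges into a
  -- difference of the vertical ones. This telescopes over the row, and the first and last columns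
  -- coincide by periodicity.
  have hrows : ∀ i, i + 1 ≤ n → ∑ j ∈ Finset.range n, segmentIntegral ω (x i j) (x i (j + 1)) =
      ∑ j ∈ Finset.range n, segmentIntegral ω (x (i + 1) j) (x (i + 1) (j + 1)) := by
    intro i hi
    rw [← sub_eq_zero, ← Finset.sum_sub_distrib]
    have : ∀ j ∈ Finset.range n, segmentIntegral ω (x i j) (x i (j + 1)) -
        segmentIntegral ω (x (i + 1) j) (x (i + 1) (j + 1)) =
        segmentIntegral ω (x i j) (x (i + 1) j) -
          segmentIntegral ω (x i (j + 1)) (x (i + 1) (j + 1)) := by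
      intro j hj
      have hj' : j + 1 ≤ n := Finset.mem_range.1 hj
      have hc := hco (x i j) ⟨_, ⟨hmem i (by omega), hmem j (by omega)⟩, rfl⟩
      have b1 := hball i j i j hi hj' (Or.inl rfl) (Or.inl rfl)
      have b2 := hball i j i (j + 1) hi hj' (Or.inl rfl) (Or.inr rfl)
      have b3 := hball i j (i + 1) j hi hj' (Or.inr rfl) (Or.inl rfl)
      have b4 := hball i j (i + 1) (j + 1) hi hj' (Or.inr rfl) (Or.inr rfl)
      have c1 := hc _ b1 _ b2 _ b4
      have c2 := hc _ b1 _ b3 _ b4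
      linarith
    rw [Finset.sum_congr rfl this, Finset.sum_range_sub'
      (fun j => segmentIntegral ω (x i j) (x (i + 1) j)), sub_eq_zero]
    have : ∀ i, x i 0 = x i n := fun i => by
      simp only [x, Nat.cast_zero, zero_div, div_self hnR.ne', hXper]
    rw [this i, this (i + 1)]
  have hall : ∀ i, i ≤ n → ∑ j ∈ Finset.range n, segmentIntegral ω (x 0 j) (x 0 (j + 1)) =
      ∑ j ∈ Finset.range n, segmentIntegral ω (x i j) (x i (j + 1)) := by
    intro i
    induction i with
    | zero => intro; rfl
    | succ i ih => intro hi; rw [ih (by omega), hrows i hi]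
  have hlast : ∑ j ∈ Finset.range n, segmentIntegral ω (x n j) (x n (j + 1)) = 0 := by
    refine Finset.sum_eq_zero fun j _ => ?_
    simp only [x, div_self hnR.ne', hX1, segmentIntegral_self]
  have := (hall n le_rfl).trans hlast
  simpa only [x, Nat.cast_zero, zero_div, hX0] using this

end

/-! ### Riemann–Stieltjes integrals. -/

theorem mem_Icc_of_partition {N : ℕ} {t ξ : ℕ → ℝ} {δ : ℝ} (h0 : t 0 = 0) (h1 : t N = 1)
    (h : ∀ i < N, ξ i ∈ Icc (t i) (t (i + 1)) ∧ t (i + 1) - t i < δ) {i : ℕ} (hi : i ≤ N) :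
    t i ∈ Icc (0 : ℝ) 1 := by
  have hmono : ∀ i j, i ≤ j → j ≤ N → t i ≤ t j := by
    intro i j hij
    induction j, hij using Nat.le_induction with
    | base => intro; rfl
    | succ j _ ih => exact fun hj => (ih (by omega)).trans ((h j hj).1.1.trans (h j hj).1.2)
  exact ⟨h0 ▸ hmono 0 i (Nat.zero_le i) hi, h1 ▸ hmono i N hi le_rfl⟩

theorem HasStieltjesIntegral.congr_right {f g g' : ℝ → ℝ} {J : ℝ}
    (h : HasStieltjesIntegral f g J) (hg : EqOn g g' (Icc 0 1)) : HasStieltjesIntegral f g' J := by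
  intro ε hε
  obtain ⟨δ, hδ, H⟩ := h ε hε
  refine ⟨δ, hδ, fun N t ξ h0 h1 hp => ?_⟩
  convert H N t ξ h0 h1 hp using 3
  refine Finset.sum_congr rfl fun i hi => ?_
  have hi := Finset.mem_range.1 hi
  rw [hg (mem_Icc_of_partition h0 h1 hp hi.le), hg (mem_Icc_of_partition h0 h1 hp hi)]

theorem HasStieltjesIntegral.sub_right {f g g' : ℝ → ℝ} {J J' : ℝ}
    (h : HasStieltjesIntegral f g J) (h' : HasStieltjesIntegral f g' J') :
    HasStieltjesIntegral f (g - g') (J - J') := by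
  intro ε hε
  obtain ⟨δ, hδ, H⟩ := h (ε / 2) (by positivity)
  obtain ⟨δ', hδ', H'⟩ := h' (ε / 2) (by positivity)
  refine ⟨min δ δ', by positivity, fun N t ξ h0 h1 hp => ?_⟩
  have e1 := H N t ξ h0 h1 fun i hi => ⟨(hp i hi).1, (hp i hi).2.trans_le (min_le_left _ _)⟩
  have e2 := H' N t ξ h0 h1 fun i hi => ⟨(hp i hi).1, (hp i hi).2.trans_le (min_le_right _ _)⟩
  have : ∑ i ∈ Finset.range N, f (ξ i) * ((g - g') (t (i + 1)) - (g - g') (t i)) =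
      ∑ i ∈ Finset.range N, f (ξ i) * (g (t (i + 1)) - g (t i)) -
        ∑ i ∈ Finset.range N, f (ξ i) * (g' (t (i + 1)) - g' (t i)) := by
    rw [← Finset.sum_sub_distrib]
    refine Finset.sum_congr rfl fun i _ => ?_
    simp only [Pi.sub_apply]; ring
  rw [this]
  rw [abs_lt] at *
  constructor <;> linarith [e1.1, e1.2, e2.1, e2.2]

/-- These left-tagged sums are the ones compared later with inscribed polygons. -/
theorem HasStieltjesIntegral.tendsto_uniform_sum {f g : ℝ → ℝ} {J : ℝ}
    (h : HasStieltjesIntegral f g J) :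
    Tendsto (fun n : ℕ => ∑ i ∈ Finset.range n,
      f ((i : ℝ) / n) * (g (((i + 1 : ℕ) : ℝ) / n) - g ((i : ℝ) / n))) atTop (𝓝 J) := by
  rw [Metric.tendsto_nhds]
  intro ε hε
  obtain ⟨δ, hδ, H⟩ := h ε hε
  have hlim : Tendsto (fun n : ℕ => (1 : ℝ) / n) atTop (𝓝 0) := tendsto_one_div_atTop_nhds_zero_nat
  filter_upwards [hlim.eventually_lt_const hδ, eventually_gt_atTop 0] with n hn hn0
  have hnR : (0 : ℝ) < n := by exact_mod_cast hn0
  refine H n (fun i => (i : ℝ) / n) (fun i => (i : ℝ) / n) (by simp) (div_self hnR.ne')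
    fun i _ => ⟨⟨le_rfl, ?_⟩, ?_⟩
  · push_cast; gcongr; linarith
  · have : ((i + 1 : ℕ) : ℝ) / n - (i : ℝ) / n = 1 / n := by push_cast; ring
    exact this.trans_lt hn

/-- Each cell `Ioc` has measure exactly the increment of `p`, so uniform continuity of `f` bounds
the total error by a small multiple of `p 1 - p 0`. -/
theorem hasStieltjesIntegral_stieltjesFunction {f : ℝ → ℝ} (hf : Continuous f)
    (p : StieltjesFunction ℝ) : HasStieltjesIntegral f p (∫ x in (0 : ℝ)..1, f x ∂p.measure) := by
  intro ε hε
  have hp : 0 ≤ p 1 - p 0 := sub_nonneg.2 (p.mono zero_le_one)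
  set ε' := ε / (2 * (p 1 - p 0 + 1)) with hε'
  have hε'0 : 0 < ε' := by positivity
  obtain ⟨δ, hδ, hunif⟩ := Metric.uniformContinuousOn_iff.1
    ((isCompact_Icc (a := (0 : ℝ)) (b := 1)).uniformContinuousOn_of_continuous hf.continuousOn)
    ε' hε'0
  refine ⟨δ, hδ, fun N t ξ h0 h1 hpart => ?_⟩
  have hint : ∀ a b, IntervalIntegrable f p.measure a b := fun a b => hf.intervalIntegrable a b
  have hsum := intervalIntegral.sum_integral_adjacent_intervals (a := t) (n := N) (μ := p.measure)
    (f := f) (fun k _ => hint _ _)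
  rw [h0, h1] at hsum
  rw [← hsum, ← Finset.sum_sub_distrib]
  have hterm : ∀ i ∈ Finset.range N,
      |f (ξ i) * (p (t (i + 1)) - p (t i)) - ∫ x in (t i)..(t (i + 1)), f x ∂p.measure| ≤
        ε' * (p (t (i + 1)) - p (t i)) := by
    intro i hi
    have hi := Finset.mem_range.1 hi
    obtain ⟨hξ, hd⟩ := hpart i hi
    have hle : t i ≤ t (i + 1) := hξ.1.trans hξ.2
    have m1 := mem_Icc_of_partition h0 h1 hpart hi.le
    have m2 := mem_Icc_of_partition h0 h1 hpart (Nat.succ_le_of_lt hi)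
    have hμ : p.measure.real (Ioc (t i) (t (i + 1))) = p (t (i + 1)) - p (t i) := by
      rw [measureReal_def, p.measure_Ioc, ENNReal.toReal_ofReal (sub_nonneg.2 (p.mono hle))]
    have hμlt : p.measure (Ioc (t i) (t (i + 1))) < ⊤ := by
      rw [p.measure_Ioc]; exact ENNReal.ofReal_lt_top
    have hc : ∫ _ in (t i)..(t (i + 1)), f (ξ i) ∂p.measure =
        f (ξ i) * (p (t (i + 1)) - p (t i)) := by
      rw [intervalIntegral.integral_of_le hle, setIntegral_const, hμ, smul_eq_mul, mul_comm]
    rw [← hc, ← intervalIntegral.integral_sub (by simp) (hint _ _),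
      intervalIntegral.integral_of_le hle, ← hμ, ← Real.norm_eq_abs]
    refine norm_setIntegral_le_of_norm_le_const hμlt fun x hx => ?_
    rw [← dist_eq_norm]
    refine (hunif (ξ i) ⟨m1.1.trans hξ.1, hξ.2.trans m2.2⟩ x
      ⟨m1.1.trans hx.1.le, hx.2.trans m2.2⟩ ?_).le
    rw [Real.dist_eq, abs_lt]
    constructor <;> linarith [hξ.1, hξ.2, hx.1, hx.2]
  calc _ ≤ ∑ i ∈ Finset.range N, ε' * (p (t (i + 1)) - p (t i)) :=
        (Finset.abs_sum_le_sum_abs _ _).trans (Finset.sum_le_sum hterm)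
    _ = ε' * (p 1 - p 0) := by
        rw [← Finset.mul_sum, Finset.sum_range_sub (fun i => p (t i)), h0, h1]
    _ < ε := by
        rw [hε', div_mul_eq_mul_div, div_lt_iff₀ (by positivity)]
        nlinarith

/-- Jordan decomposition: `g` is the difference of its variation function and a monotone function.
-/
theorem exists_hasStieltjesIntegral {f g : ℝ → ℝ} (hf : Continuous f) (hg : Continuous g)
    (hbv : BoundedVariationOn g (Icc 0 1)) : ∃ J, HasStieltjesIntegral f g J := by
  -- The extension by constants has bounded variation on the whole line; its continuity gives the
  -- right continuity that `StieltjesFunction` demands.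
  set G : ℝ → ℝ := fun t => g (projIcc 0 1 zero_le_one t) with hG
  have hGg : EqOn G g (Icc 0 1) := fun t ht => by simp [hG, projIcc_of_mem zero_le_one ht]
  have hGc : Continuous G := hg.comp (continuous_subtype_val.comp continuous_projIcc)
  have hGbv : BoundedVariationOn G univ := by
    refine ne_top_of_le_ne_top hbv ?_
    exact eVariationOn.comp_le_of_monotoneOn g (fun t : ℝ => (projIcc 0 1 zero_le_one t : ℝ))
      ((Subtype.mono_coe _).comp (monotone_projIcc zero_le_one) |>.monotoneOn _)
      (fun t _ => Subtype.coe_prop _)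
  have hvc : ∀ x, ContinuousWithinAt (variationOnFromTo G univ 0) (Ici x) x := fun x =>
    hGbv.continuousWithinAt_variationOnFromTo_Ici hGc.continuousWithinAt
  have hloc := hGbv.locallyBoundedVariationOn
  let p : StieltjesFunction ℝ := ⟨variationOnFromTo G univ 0,
    monotoneOn_univ.1 (variationOnFromTo.monotoneOn hloc (mem_univ 0)), hvc⟩
  let q : StieltjesFunction ℝ := ⟨variationOnFromTo G univ 0 - G,
    monotoneOn_univ.1 (variationOnFromTo.sub_self_monotoneOn hloc (mem_univ 0)),
    fun x => (hvc x).sub hGc.continuousWithinAt⟩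
  refine ⟨_, ((hasStieltjesIntegral_stieltjesFunction hf p).sub_right
    (hasStieltjesIntegral_stieltjesFunction hf q)).congr_right fun t ht => ?_⟩
  rw [← hGg ht]
  simp [p, q]

/-! ### Stieltjes sums and inscribed polygons. -/

section

variable {V : Type*} [NormedAddCommGroup V] [NormedSpace ℝ V]

theorem sum_norm_sub_le_variation {F : Type*} [SeminormedAddCommGroup F] {c : ℝ → F} (hbv : BoundedVariationOn c (Icc 0 1)) {n : ℕ}
    (hn : 0 < n) : ∑ i ∈ Finset.range n, ‖c (((i + 1 : ℕ) : ℝ) / n) - c ((i : ℝ) / n)‖ ≤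
      (eVariationOn c (Icc 0 1)).toReal := by
  have hnR : (0 : ℝ) < n := by exact_mod_cast hn
  have h := eVariationOn.sum_le_of_monotoneOn_Icc (f := c) (s := Icc (0 : ℝ) 1) (m := 0) (n := n)
    (u := fun i : ℕ => (i : ℝ) / n)
    (fun i _ j _ hij => by dsimp only; gcongr)
    (fun i hi => ⟨by positivity, (div_le_one hnR).2 (by exact_mod_cast hi.2)⟩)
  rw [← Finset.range_eq_Ico] at h
  have h2 := ENNReal.toReal_mono hbv h
  rw [ENNReal.toReal_sum (fun i _ => edist_ne_top _ _)] at h2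
  refine le_trans (le_of_eq (Finset.sum_congr rfl fun i _ => ?_)) h2
  rw [← dist_eq_norm, dist_edist]

/-- Near the compact curve `ω` varies little along a short chord, so each error is a small multiple
of the chord length, and the chord lengths sum to at most the variation. -/
theorem tendsto_sum_sub_segmentIntegral {ω : V → V →L[ℝ] ℝ} {W : Set V} (hW : IsOpen W)
    (hω : ContinuousOn ω W) {c : ℝ → V} (hc : ContinuousOn c (Icc 0 1))
    (hcW : ∀ t ∈ Icc (0 : ℝ) 1, c t ∈ W) (hbv : BoundedVariationOn c (Icc 0 1)) :
    Tendsto (fun n : ℕ => ∑ i ∈ Finset.range n,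
      (ω (c ((i : ℝ) / n)) (c (((i + 1 : ℕ) : ℝ) / n) - c ((i : ℝ) / n)) -
        segmentIntegral ω (c ((i : ℝ) / n)) (c (((i + 1 : ℕ) : ℝ) / n)))) atTop (𝓝 0) := by
  rw [Metric.tendsto_nhds]
  intro ε hε
  set T := (eVariationOn c (Icc 0 1)).toReal
  have hT : 0 ≤ T := ENNReal.toReal_nonneg
  set ε' := ε / (2 * (T + 1)) with hε'
  have hε'0 : 0 < ε' := by positivity
  have hKc : IsCompact (c '' Icc 0 1) := isCompact_Icc.image_of_continuousOn hc
  have hKW : c '' Icc 0 1 ⊆ W := by rintro _ ⟨t, ht, rfl⟩; exact hcW t ht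
  have hU := hKc.uniformContinuousAt_of_continuousAt ω
    (fun a ha => hω.continuousAt (hW.mem_nhds (hKW ha))) (Metric.dist_mem_uniformity hε'0)
  obtain ⟨ρ₁, hρ₁, hU⟩ := Metric.mem_uniformity_dist.1 hU
  obtain ⟨ρ₂, hρ₂, hthick⟩ := hKc.exists_thickening_subset_open hW hKW
  set ρ := min ρ₁ ρ₂ with hρ
  have hρ0 : 0 < ρ := lt_min hρ₁ hρ₂
  obtain ⟨η, hη, hunif⟩ := Metric.uniformContinuousOn_iff.1
    (isCompact_Icc.uniformContinuousOn_of_continuous hc) ρ hρ0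
  have hlim : Tendsto (fun n : ℕ => (1 : ℝ) / n) atTop (𝓝 0) := tendsto_one_div_atTop_nhds_zero_nat
  filter_upwards [hlim.eventually_lt_const hη, eventually_gt_atTop 0] with n hn hn0
  have hnR : (0 : ℝ) < n := by exact_mod_cast hn0
  rw [dist_zero_right]
  have hterm : ∀ i ∈ Finset.range n,
      ‖ω (c ((i : ℝ) / n)) (c (((i + 1 : ℕ) : ℝ) / n) - c ((i : ℝ) / n)) -
        segmentIntegral ω (c ((i : ℝ) / n)) (c (((i + 1 : ℕ) : ℝ) / n))‖ ≤
        ε' * ‖c (((i + 1 : ℕ) : ℝ) / n) - c ((i : ℝ) / n)‖ := by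
    intro i hi
    have hi := Finset.mem_range.1 hi
    have m1 : (i : ℝ) / n ∈ Icc (0 : ℝ) 1 :=
      ⟨by positivity, (div_le_one hnR).2 (by exact_mod_cast hi.le)⟩
    have m2 : ((i + 1 : ℕ) : ℝ) / n ∈ Icc (0 : ℝ) 1 :=
      ⟨by positivity, (div_le_one hnR).2 (by exact_mod_cast hi)⟩
    have hstep : ((i + 1 : ℕ) : ℝ) / n - (i : ℝ) / n = 1 / n := by push_cast; ring
    have hd : dist (c ((i : ℝ) / n)) (c (((i + 1 : ℕ) : ℝ) / n)) < ρ := by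
      refine hunif _ m1 _ m2 ?_
      rw [dist_comm, Real.dist_eq, hstep, abs_of_pos (by positivity)]
      exact hn
    set x := c ((i : ℝ) / n) with hx
    set y := c (((i + 1 : ℕ) : ℝ) / n) with hy
    have hxK : x ∈ c '' Icc 0 1 := ⟨_, m1, rfl⟩
    have hseg : ∀ τ ∈ Icc (0 : ℝ) 1, dist x (x + τ • (y - x)) < ρ := by
      intro τ hτ
      have := (convex_ball x ρ).add_smul_sub_mem (Metric.mem_ball_self hρ0)
        (Metric.mem_ball'.2 hd) hτ
      exact Metric.mem_ball'.1 this
    have hsegW : ∀ τ ∈ Icc (0 : ℝ) 1, x + τ • (y - x) ∈ W := fun τ hτ =>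
      hthick (Metric.mem_thickening_iff.2 ⟨x, hxK, by
        rw [dist_comm]; exact (hseg τ hτ).trans_le (min_le_right _ _)⟩)
    have hcont : ContinuousOn (fun τ : ℝ => ω (x + τ • (y - x)) (y - x)) (uIcc 0 1) := by
      rw [uIcc_of_le zero_le_one]
      exact (hω.comp (f := fun τ : ℝ => x + τ • (y - x)) (by fun_prop) hsegW).clm_apply
        continuousOn_const
    have hconst : ω x (y - x) = ∫ _ in (0 : ℝ)..1, ω x (y - x) := by simp
    unfold segmentIntegral
    rw [hconst, ← intervalIntegral.integral_sub (by simp) hcont.intervalIntegrable]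
    refine (intervalIntegral.norm_integral_le_of_norm_le_const
      (C := ε' * ‖y - x‖) fun τ hτ => ?_).trans (by simp)
    rw [uIoc_of_le zero_le_one] at hτ
    have hτ' : τ ∈ Icc (0 : ℝ) 1 := Ioc_subset_Icc_self hτ
    rw [← sub_apply]
    refine (ContinuousLinearMap.le_opNorm _ _).trans ?_
    gcongr
    rw [← dist_eq_norm]
    exact (hU ((hseg τ hτ').trans_le (min_le_left _ _)) hxK).le
  calc _ ≤ ∑ i ∈ Finset.range n, ε' * ‖c (((i + 1 : ℕ) : ℝ) / n) - c ((i : ℝ) / n)‖ :=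
        (norm_sum_le _ _).trans (Finset.sum_le_sum hterm)
    _ ≤ ε' * T := by
        rw [← Finset.mul_sum]
        gcongr
        exact sum_norm_sub_le_variation hbv hn0
    _ < ε := by
        rw [hε', div_mul_eq_mul_div, div_lt_iff₀ (by positivity)]
        nlinarith

/-- The Riemann–Stieltjes sums of a closed form along a rectifiable null-homotopic loop tend to
zero. -/
theorem IsGateauxClosedOn.tendsto_sum_zero [FiniteDimensional ℝ V] {ω : V → V →L[ℝ] ℝ} {W : Set V}
    (hω : IsGateauxClosedOn ω W) (hW : IsOpen W) (γ : C(UnitAddCircle, W))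
    (hγ : γ.Nullhomotopic)
    (hbv : BoundedVariationOn (fun t : ℝ => (γ (t : UnitAddCircle) : V)) (Icc 0 1)) :
    Tendsto (fun n : ℕ => ∑ i ∈ Finset.range n,
      ω (γ (((i : ℝ) / n : ℝ) : UnitAddCircle) : V)
        ((γ ((((i + 1 : ℕ) : ℝ) / n : ℝ) : UnitAddCircle) : V) -
          (γ (((i : ℝ) / n : ℝ) : UnitAddCircle) : V))) atTop (𝓝 0) := by
  have hc : Continuous fun t : ℝ => (γ (t : UnitAddCircle) : V) :=
    continuous_subtype_val.comp (γ.continuous.comp (AddCircle.continuous_mk' (1 : ℝ)))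
  refine (tendsto_sum_sub_segmentIntegral hW hω.continuousOn hc.continuousOn
    (fun _ _ => Subtype.coe_prop _) hbv).congr' ?_
  filter_upwards [hω.eventually_sum_segmentIntegral_eq_zero hW γ hγ] with n hn
  rw [Finset.sum_sub_distrib, hn, sub_zero]

end

/-! ### The closed form attached to a monogenic function. -/

section

variable {A : Type*} [CommRing A] [Algebra ℂ A] {k : ℕ}

theorem point_add (e : Fin k → A) (x y : EuclideanSpace ℝ (Fin k)) :
    point e (x + y) = point e x + point e y := by
  simp [point, add_smul, Finset.sum_add_distrib]

theorem point_smul (e : Fin k → A) (c : ℝ) (x : EuclideanSpace ℝ (Fin k)) :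
    point e (c • x) = c • point e x := by
  simp [point, mul_smul, Finset.smul_sum]

theorem point_mem_realSpan (e : Fin k → A) (x : EuclideanSpace ℝ (Fin k)) :
    point e x ∈ realSpan e :=
  Submodule.sum_mem _ fun j _ => Submodule.smul_mem _ _ (Submodule.subset_span (mem_range_self j))

/-- The 1-form `ℓ (Φ dζ)` in the coordinates of `E_k`. -/
def coordForm (e : Fin k → A) (Φ : A → A) (ℓ : A →ₗ[ℝ] ℝ) (x : EuclideanSpace ℝ (Fin k)) :
    EuclideanSpace ℝ (Fin k) →L[ℝ] ℝ :=
  ∑ j, ℓ (e j * Φ (point e x)) • EuclideanSpace.proj (𝕜 := ℝ) j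

theorem coordForm_apply (e : Fin k → A) (Φ : A → A) (ℓ : A →ₗ[ℝ] ℝ)
    (x h : EuclideanSpace ℝ (Fin k)) :
    coordForm e Φ ℓ x h = ℓ (point e h * Φ (point e x)) := by
  conv_rhs => rw [point, Finset.sum_mul, map_sum]
  simp [coordForm, mul_comm]

theorem hasDerivAt_zero_of_tendsto_right {f : ℝ → ℝ} {d : ℝ}
    (hr : Tendsto (fun ε : ℝ => ε⁻¹ • (f ε - f 0)) (𝓝[>] 0) (𝓝 d))
    (hl : Tendsto (fun ε : ℝ => ε⁻¹ • (f (-ε) - f 0)) (𝓝[>] 0) (𝓝 (-d))) :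
    HasDerivAt f d 0 := by
  rw [hasDerivAt_iff_tendsto_slope_left_right]
  constructor
  · have hneg : Tendsto (fun t : ℝ => -t) (𝓝[<] 0) (𝓝[>] 0) := by
      simpa using tendsto_neg_nhdsLT (a := (0 : ℝ))
    refine (by simpa using (hl.comp hneg).neg : Tendsto _ _ (𝓝 d)).congr fun t => ?_
    simp [slope_def_field]
    ring
  · refine hr.congr fun t => ?_
    simp [slope_def_field]
    ring

variable [TopologicalSpace A] [IsTopologicalAddGroup A] [ContinuousSMul ℂ A] [T2Space A]

/-- The bilinear form is `ℓ (h' h Φ')`, symmetric by commutativity. The monogenic limits are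
one-sided; those along `h` and `-h` together give a two-sided derivative. -/
theorem IsMonogenicOn.isGateauxClosedOn [Module.Finite ℂ A] {e : Fin k → A} {Φ : A → A} {Ω : Set A}
    (hΦ : IsMonogenicOn e Φ Ω) (ℓ : A →ₗ[ℝ] ℝ) :
    IsGateauxClosedOn (coordForm e Φ ℓ) (realSet e Ω) := by
  have : Module.Finite ℝ A := Module.Finite.trans ℂ A
  have : ContinuousSMul ℝ A := IsScalarTower.continuousSMul ℂ
  have hcont : ∀ a : A, Continuous fun b => ℓ (a * b) := fun a =>
    (ℓ ∘ₗ LinearMap.mulLeft ℝ a).continuous_of_finiteDimensional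
  refine ⟨?_, fun x hx => ?_⟩
  · unfold coordForm
    refine continuousOn_finsetSum _ fun j _ => ?_
    exact ((hcont (e j)).comp_continuousOn hΦ.continuousOn).smul continuousOn_const
  · obtain ⟨d, hd⟩ := hΦ.gateaux _ hx
    let pt : EuclideanSpace ℝ (Fin k) →ₗ[ℝ] A :=
      { toFun := point e, map_add' := point_add e, map_smul' := point_smul e }
    let B : EuclideanSpace ℝ (Fin k) →ₗ[ℝ] EuclideanSpace ℝ (Fin k) →ₗ[ℝ] ℝ :=
      ((LinearMap.mul ℝ A).compr₂ (ℓ ∘ₗ LinearMap.mulLeft ℝ d)).compl₁₂ pt pt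
    have hB : ∀ h h', B h h' = ℓ (point e h' * (point e h * d)) := fun h h' => by
      simp only [B, pt, LinearMap.compl₁₂_apply, LinearMap.compr₂_apply, LinearMap.comp_apply,
        LinearMap.mul_apply', LinearMap.mulLeft_apply, LinearMap.coe_mk, AddHom.coe_mk]
      congr 1; ring
    refine ⟨B, fun h h' => ?_, fun h h' => ?_⟩
    · rw [hB, hB]; congr 1; ring
    · have hdir : ∀ h : EuclideanSpace ℝ (Fin k), Tendsto (fun ε : ℝ => ε⁻¹ •
          (coordForm e Φ ℓ (x + ε • h) h' - coordForm e Φ ℓ x h')) (𝓝[>] 0)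
          (𝓝 (ℓ (point e h' * (point e h * d)))) := by
        intro h
        refine (((hcont (point e h')).tendsto _).comp (hd _ (point_mem_realSpan e h))).congr ?_
        intro ε
        simp only [Function.comp_apply, coordForm_apply, point_add, point_smul]
        rw [← map_sub, ← mul_sub, mul_smul_comm, map_smul]
      rw [hB]
      refine hasDerivAt_zero_of_tendsto_right ?_ ?_
      · simpa using hdir h
      · have h1 := hdir (-h)
        have h2 : point e (-h) = -point e h := map_neg pt h
        rw [h2] at h1
        simpa using h1

end

end Monogenic

end

/-! ### The Cauchy theorem. -/

theorem theorem2 {A : Type*} [CommRing A] [Algebra ℂ A]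
    -- the topology of the finite-dimensional complex vector space `A`
    [TopologicalSpace A] [IsTopologicalAddGroup A] [ContinuousSMul ℂ A] [T2Space A]
    {n k : ℕ} (I : Module.Basis (Fin n) ℂ A)
    (hk : 2 ≤ k) (e : Fin k → A) (he_one : e ⟨0, by omega⟩ = 1)
    (he : LinearIndependent ℝ e)
    -- every multiplicative functional of `A` maps `E_k` onto `ℂ`
    (hf : ∀ f : A →ₐ[ℂ] ℂ, f '' (Monogenic.realSpan e : Set A) = univ)
    (Ω : Set A) (hΩ : Monogenic.IsDomainIn e Ω)
    (Φ : A → A) (hΦ : Monogenic.IsMonogenicOn e Φ Ω)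
    -- a closed Jordan rectifiable curve in `Ω`, given in coordinates, homotopic to a point in `Ω`
    (γ : C(UnitAddCircle, Monogenic.realSet e Ω)) (hγ_jordan : Function.Injective γ)
    (hγ_rect : BoundedVariationOn
      (fun t : ℝ => (γ (t : UnitAddCircle) : EuclideanSpace ℝ (Fin k))) (Icc 0 1))
    (hγ_null : γ.Nullhomotopic) :
    Monogenic.HasCurveIntegral I e Φ
      (fun t : ℝ => (γ (t : UnitAddCircle) : EuclideanSpace ℝ (Fin k))) 0 := by

  have : Module.Finite ℂ A := Module.Finite.of_basis I
  set c : ℝ → EuclideanSpace ℝ (Fin k) := fun t => γ (t : UnitAddCircle) with hc_def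
  have hc : Continuous c :=
    continuous_subtype_val.comp (γ.continuous.comp (AddCircle.continuous_mk' (1 : ℝ)))
  have hcj : ∀ j, Continuous fun t => c t j := fun j => by fun_prop
  have hbvj : ∀ j, BoundedVariationOn (fun t => c t j) (Icc 0 1) := fun j =>
    (EuclideanSpace.proj j : EuclideanSpace ℝ (Fin k) →L[ℝ] ℝ).lipschitz.comp_boundedVariationOn
      hγ_rect
  have hΦc : Continuous fun t => Φ (Monogenic.point e (c t)) :=
    hΦ.continuousOn.comp_continuous hc fun t => Subtype.coe_prop _
  have hcoord : ∀ r, Continuous fun t => I.repr (Φ (Monogenic.point e (c t))) r := fun r =>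
    ((I.coord r).continuous_of_finiteDimensional).comp hΦc
  choose P hP using fun j r => Monogenic.exists_hasStieltjesIntegral
    (Complex.continuous_re.comp (hcoord r)) (hcj j) (hbvj j)
  choose Q hQ using fun j r => Monogenic.exists_hasStieltjesIntegral
    (Complex.continuous_im.comp (hcoord r)) (hcj j) (hbvj j)
  refine ⟨P, Q, hP, hQ, ?_⟩
  symm
  -- Real functionals separate points, and each gives a real 1-form.
  rw [← Module.forall_dual_apply_eq_zero_iff ℝ]
  intro ℓ
  have hz : ℓ ((∑ j, e j * ∑ r, P j r • I r) + Complex.I • (∑ j, e j * ∑ r, Q j r • I r)) =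
      ∑ j, ∑ r, (P j r * ℓ (e j * I r) + Q j r * ℓ (e j * Complex.I • I r)) := by
    simp only [Finset.mul_sum, Finset.smul_sum, map_add, map_sum, Finset.sum_add_distrib,
      mul_smul_comm, smul_comm Complex.I, map_smul, smul_eq_mul]
  rw [hz]
  have hlim := tendsto_finsetSum Finset.univ fun j _ => tendsto_finsetSum Finset.univ fun r _ =>
    ((hP j r).tendsto_uniform_sum.mul_const (ℓ (e j * I r))).add
      ((hQ j r).tendsto_uniform_sum.mul_const (ℓ (e j * Complex.I • I r)))
  -- The same uniform sums tend to `ℓ` of the integral and, by closedness of the form, to zero.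
  refine tendsto_nhds_unique hlim
    (((hΦ.isGateauxClosedOn ℓ).tendsto_sum_zero hΩ.isOpen γ hγ_null hγ_rect).congr fun N => ?_)
  have hΦI : ∀ a : A, a = ∑ r, ((I.repr a r).re • I r + (I.repr a r).im • Complex.I • I r) := by
    intro a
    conv_lhs => rw [← I.sum_repr a]
    refine Finset.sum_congr rfl fun r _ => ?_
    conv_lhs => rw [← Complex.re_add_im (I.repr a r), add_smul, mul_smul]
    simp only [Complex.coe_smul]
  have hterm : ∀ x h : EuclideanSpace ℝ (Fin k), Monogenic.coordForm e Φ ℓ x h =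
      ∑ j, ∑ r, ((I.repr (Φ (Monogenic.point e x)) r).re * h j * ℓ (e j * I r) +
        (I.repr (Φ (Monogenic.point e x)) r).im * h j * ℓ (e j * Complex.I • I r)) := by
    intro x h
    rw [Monogenic.coordForm_apply, Monogenic.point, Finset.sum_mul, map_sum]
    refine Finset.sum_congr rfl fun j _ => ?_
    conv_lhs => rw [hΦI (Φ _)]
    rw [Finset.mul_sum, map_sum]
    refine Finset.sum_congr rfl fun r _ => ?_
    simp only [smul_mul_assoc, mul_add, mul_smul_comm, map_smul, map_add, smul_eq_mul,
      smul_comm Complex.I (h j)]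
    ring
  simp only [hterm, Finset.sum_mul, ← Finset.sum_add_distrib]
  rw [Finset.sum_comm]
  refine Finset.sum_congr rfl fun j _ => ?_
  rw [Finset.sum_comm]
  rfl
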